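/- Let $\Omega\subseteq\mathbb R^2$ be an open set of points $(t,x)$, let $A,C\colon\Omega\to\mathbb R$ be smooth functions without zeros, and consider the equation $$u_t+C(t,x)\,u\,u_x=A(t,x)\,u_{xx}.\qquad(1)$$ A point transformation is a smooth diffeomorphism $\varphi\colon(t,x,u)\mapsto(\tilde t,\tilde x,\tilde u)$ between open subsets of $\mathbb R^3$; each of $\tilde t,\tilde x,\tilde u$ may depend on all of $t,x,u$. It reduces (1) to the classical Burgers equation $$\tilde u_{\tilde t}+\tilde u\,\tilde u_{\tilde x}=\tilde u_{\tilde x\tilde x}$$ if a second-order jet over the domain of $\varphi$ at which the second prolongation of $\varphi$ is defined satisfies (1) if and only if its image satisfies the Burgers equation. Equation (1) is called reducible over $V\subseteq\Omega$ if there is such a $\varphi$ whose domain projects onto $V$ under $(t,x,u)\mapsto(t,x)$. 1. Every point of $\Omega$ has an open neighbourhood in $\Omega$ over which (1) is reducible if and only if, on $\Omega$, $$\Big(\frac{C^2}{A}\Big)_x=0\quad\text{and}\quad\Big(\frac{C}{A}\Big)_t=-C_{xx}.\qquad(2)$$ 2. If $\Omega$ is convex, then (1) is reducible over $\Omega$ if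 and only if (2) holds on $\Omega$. 3. If (2) holds on $\Omega$, then for every convex open set $V\subseteq\Omega$ there are smooth functions $T$ (of $t$, on the projection of $V$) and $X$ (of $(t,x)$, on $V$) with $$T_t=\frac{C^2}{A},\qquad X_x=\frac{C}{A}\qquad\text{on }V$$ such that the transformation $\tilde t=T(t)$, $\tilde x=X(t,x)$, $\tilde u=U^1u+U^0$ with $U^1=1$ and $U^0=0$ is a point transformation with domain $V\times\mathbb R$ that reduces (1) to the classical Burgers equation. -/

import Mathlib

open scoped ContDiff Topology

/-- The plane of independent variables: a point is `(t, x)`. -/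
abbrev BaseSpaceTX : Type := ℝ × ℝ

/-- The space of independent and dependent variables: a point is `((t, x), u)`. -/
abbrev TotalSpaceTXU : Type := BaseSpaceTX × ℝ

/-- The partial derivative with respect to `t`. -/
noncomputable def partialT (f : BaseSpaceTX → ℝ) (p : BaseSpaceTX) : ℝ := fderiv ℝ f p (1, 0)

/-- The partial derivative with respect to `x`. -/
noncomputable def partialX (f : BaseSpaceTX → ℝ) (p : BaseSpaceTX) : ℝ := fderiv ℝ f p (0, 1)

/-- The function `u` satisfies the equation `u_t + C u u_x = A u_xx` at the point `p`. For `u` smooth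
near `p` this says that the `2`-jet of `u` at `p` lies in the submanifold of the second-order jet
space that is defined by the equation. -/
def SatisfiesAt (A C u : BaseSpaceTX → ℝ) (p : BaseSpaceTX) : Prop :=
  partialT u p + C p * u p * partialX u p = A p * partialX (partialX u) p

/-- `Φ` is a point transformation with domain `W`: a smooth diffeomorphism of the open set `W` of the
space with coordinates `(t, x, u)` onto an open set of that space (the image is open, and the inverse
is smooth, by the inverse function theorem). All three components of `Φ` may depend on `t`, `x`
and `u`. -/
structure IsPointTransformation (W : Set TotalSpaceTXU) (Φ : TotalSpaceTXU → TotalSpaceTXU) : Prop where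
  isOpen : IsOpen W
  smooth : ContDiffOn ℝ ∞ Φ W
  injOn : Set.InjOn Φ W
  bijective_fderiv : ∀ z ∈ W, Function.Bijective (fderiv ℝ Φ z)

/-- The base point `(t̃, x̃)` of the image under `Φ` of the point `(q, u q)` of the graph of `u`. -/
def baseMap (Φ : TotalSpaceTXU → TotalSpaceTXU) (u : BaseSpaceTX → ℝ) (q : BaseSpaceTX) : BaseSpaceTX := (Φ (q, u q)).1

/-- Near the point `p`, the transformation `Φ` with domain `W` maps the graph of the smooth function
`u` to the graph of the smooth function `v`, and it does so transversally: the map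
`(t, x) ↦ (t̃, x̃)` induced by `u` has an invertible derivative at `p`. The `2`-jets of `u` at `p` and
of `v` at `baseMap Φ u p` correspond then to each other under the second prolongation of `Φ`, and
every pair of `2`-jets that correspond to each other arises so. -/
structure MapsGraphAt (W : Set TotalSpaceTXU) (Φ : TotalSpaceTXU → TotalSpaceTXU) (u v : BaseSpaceTX → ℝ) (p : BaseSpaceTX) : Prop where
  mem : (p, u p) ∈ W
  smooth_source : ContDiffAt ℝ ∞ u p
  smooth_target : ContDiffAt ℝ ∞ v (baseMap Φ u p)
  transversal : Function.Bijective (fderiv ℝ (baseMap Φ u) p)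
  graph_eq : ∀ᶠ q in 𝓝 p, (Φ (q, u q)).2 = v (baseMap Φ u q)

/-- The prolongation of `Φ` (with domain `W`) maps the equation `u_t + C u u_x = A u_xx` to the
equation `v_t + C' v v_x = A' v_xx`: a `2`-jet over `W` at which the prolongation is defined lies in
the first equation if and only if its image lies in the second one. -/
def Connects (W : Set TotalSpaceTXU) (Φ : TotalSpaceTXU → TotalSpaceTXU) (A C A' C' : BaseSpaceTX → ℝ) : Prop :=
  ∀ (u v : BaseSpaceTX → ℝ) (p : BaseSpaceTX), MapsGraphAt W Φ u v p →
    (SatisfiesAt A C u p ↔ SatisfiesAt A' C' v (baseMap Φ u p))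

/-- `Φ` is a point transformation with domain `W` that maps `u_t + C u u_x = A u_xx` to the classical
Burgers equation, which is the equation of this form with both coefficients equal to one. -/
def ReducesToBurgers (A C : BaseSpaceTX → ℝ) (W : Set TotalSpaceTXU) (Φ : TotalSpaceTXU → TotalSpaceTXU) : Prop :=
  IsPointTransformation W Φ ∧ Connects W Φ A C (fun _ => 1) (fun _ => 1)

/-- Over the set `V` of values of `(t, x)`, the equation `u_t + C u u_x = A u_xx` reduces to the
classical Burgers equation by a single point transformation. The domain of the transformation projects
onto `V`, but need not contain all values of `u`. -/
def ReducibleOver (A C : BaseSpaceTX → ℝ) (V : Set BaseSpaceTX) : Prop :=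
  ∃ (W : Set TotalSpaceTXU) (Φ : TotalSpaceTXU → TotalSpaceTXU), Prod.fst '' W = V ∧ ReducesToBurgers A C W Φ

/-- The equation reduces to the classical Burgers equation near each point of `Ω`. -/
def LocallyReducibleOn (A C : BaseSpaceTX → ℝ) (Ω : Set BaseSpaceTX) : Prop :=
  ∀ p ∈ Ω, ∃ V : Set BaseSpaceTX, p ∈ V ∧ V ⊆ Ω ∧ ReducibleOver A C V

/-- The constraints `((C)²/A)_x = 0` and `(C/A)_t = -C_xx` on `Ω`. -/
def BurgersConstraints (A C : BaseSpaceTX → ℝ) (Ω : Set BaseSpaceTX) : Prop :=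
  ∀ p ∈ Ω, partialX (fun q => C q ^ 2 / A q) p = 0 ∧ partialT (fun q => C q / A q) p = -partialX (partialX C) p

/-- The transformation `t̃ = T(t)`, `x̃ = X(t,x)`, `ũ = U¹(t) u + U⁰(t,x)`. -/
def affineTransformation (T : ℝ → ℝ) (X : BaseSpaceTX → ℝ) (U1 : ℝ → ℝ) (U0 : BaseSpaceTX → ℝ) :
    TotalSpaceTXU → TotalSpaceTXU :=
  fun z => ((T z.1.1, X z.1), U1 z.1.1 * z.2 + U0 z.1)

/-! Write `Φ = (T, X, U)` and restrict its components to the graph of `u`, obtaining `τ, ξ, η`. The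
image of the graph is the graph of `v` with `v_x = (τ_t η_x - τ_x η_t) / J` and `v_t = (η_t ξ_x -
η_x ξ_t) / J`, where `J = τ_t ξ_x - τ_x ξ_t`. After denominators are cleared, the Burgers equation
for `v` is therefore a condition on the 2-jet of `u` that is affine in `u_tt, u_tx, u_xx`
(`satisfiesAt_burgers_iff`, `burgers_graphJet_iff`).

Necessity: equation (1) leaves `u_tt` and `u_tx` free, which forces `T = T(t)`
(`DerivJet.x_eq_zero_of_burgers_iff`). Comparing the dependence on `u_t` then gives `X_u = 0` and
`T_t = A X_x^2`; comparing powers of `u_x` gives `U_uu = 0` and two more equations. Their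
`u`-derivatives yield `C = A X_x U_u` and `U_xu = 0` (`invariants_of_determining_equations`). Hence
`C^2/A = T_t U_u^2` has zero `x`-derivative, and `C/A = X_x U_u` has `t`-derivative `-C_xx`.

Sufficiency: take `U = u` and solve `T_t = C^2/A`, `X_x = C/A`, `X_t = -C_x`. The two constraints in
(2) are exactly the integrability conditions, and on a convex set they suffice
(`exists_time_primitive`, `exists_potential`). Convexity also makes the resulting map injective.
Balls give the local statement. -/

/-! ### Calculus of directional derivatives -/

section DirectionalDerivative

variable {E : Type*} [NormedAddCommGroup E] [NormedSpace ℝ E]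

/-- The derivative of `f` in the direction `v`, as a function of the point. -/
noncomputable def dirDeriv (v : E) (f : E → ℝ) (z : E) : ℝ := fderiv ℝ f z v

theorem ContDiffAt.dirDeriv {m n : ℕ∞ω} {f : E → ℝ} {z : E} (hf : ContDiffAt ℝ n f z)
    (hmn : m + 1 ≤ n) (v : E) : ContDiffAt ℝ m (dirDeriv v f) z :=
  (hf.fderiv_right hmn).clm_apply contDiffAt_const

theorem ContDiffOn.dirDeriv {W : Set E} {f : E → ℝ} (hf : ContDiffOn ℝ ∞ f W) (hW : IsOpen W)
    (v : E) : ContDiffOn ℝ ∞ (dirDeriv v f) W := fun z hz =>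
  ((hf.contDiffAt (hW.mem_nhds hz)).dirDeriv (by simp) v).contDiffWithinAt

theorem ContDiffOn.differentiableAt_of_isOpen {W : Set E} {f : E → ℝ} (hf : ContDiffOn ℝ ∞ f W)
    (hW : IsOpen W) {z : E} (hz : z ∈ W) : DifferentiableAt ℝ f z :=
  (hf.contDiffAt (hW.mem_nhds hz)).differentiableAt (by simp)

theorem dirDeriv_comm {f : E → ℝ} {z : E} (hf : ContDiffAt ℝ 2 f z) (v w : E) :
    dirDeriv v (dirDeriv w f) z = dirDeriv w (dirDeriv v f) z := by
  have hd : DifferentiableAt ℝ (fderiv ℝ f) z :=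
    (hf.fderiv_right (m := 1) (by norm_num)).differentiableAt (by simp)
  have hs : IsSymmSndFDerivAt ℝ f z := hf.isSymmSndFDerivAt (by simp)
  have key (a b : E) : dirDeriv a (dirDeriv b f) z = fderiv ℝ (fderiv ℝ f) z a b := by
    have : HasFDerivAt (fun y => fderiv ℝ f y b) _ z := hd.hasFDerivAt.clm_apply
      (hasFDerivAt_const b z)
    change fderiv ℝ (fun y => fderiv ℝ f y b) z a = _
    rw [this.fderiv]
    simp
  rw [key, key]
  exact hs.eq v w

theorem dirDeriv_add {f g : E → ℝ} {z : E} (hf : DifferentiableAt ℝ f z)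
    (hg : DifferentiableAt ℝ g z) (v : E) :
    dirDeriv v (fun y => f y + g y) z = dirDeriv v f z + dirDeriv v g z := by
  simp [dirDeriv, fderiv_fun_add hf hg]

theorem dirDeriv_sub {f g : E → ℝ} {z : E} (hf : DifferentiableAt ℝ f z)
    (hg : DifferentiableAt ℝ g z) (v : E) :
    dirDeriv v (fun y => f y - g y) z = dirDeriv v f z - dirDeriv v g z := by
  simp [dirDeriv, fderiv_fun_sub hf hg]

theorem dirDeriv_neg (f : E → ℝ) (z v : E) :
    dirDeriv v (fun y => -f y) z = -dirDeriv v f z := by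
  simp [dirDeriv, fderiv_fun_neg]

theorem dirDeriv_mul {f g : E → ℝ} {z : E} (hf : DifferentiableAt ℝ f z)
    (hg : DifferentiableAt ℝ g z) (v : E) :
    dirDeriv v (fun y => f y * g y) z = dirDeriv v f z * g z + f z * dirDeriv v g z := by
  simp [dirDeriv, fderiv_fun_mul hf hg]; ring

theorem dirDeriv_const (c : ℝ) (z v : E) : dirDeriv v (fun _ => c) z = 0 := by
  simp [dirDeriv]

theorem dirDeriv_congr {f g : E → ℝ} {z : E} (h : f =ᶠ[𝓝 z] g) (v : E) :
    dirDeriv v f z = dirDeriv v g z := by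
  simp [dirDeriv, h.fderiv_eq]

theorem dirDeriv_congr_on {W : Set E} (hW : IsOpen W) {f g : E → ℝ} (h : ∀ z ∈ W, f z = g z)
    (v : E) : ∀ z ∈ W, dirDeriv v f z = dirDeriv v g z := fun _ hz =>
  dirDeriv_congr (Filter.eventually_of_mem (hW.mem_nhds hz) h) v

theorem dirDeriv_eq_zero_on {W : Set E} (hW : IsOpen W) {f : E → ℝ} (h : ∀ z ∈ W, f z = 0)
    (v : E) : ∀ z ∈ W, dirDeriv v f z = 0 := fun z hz => by
  rw [dirDeriv_congr_on hW h v z hz, dirDeriv_const]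

end DirectionalDerivative

/-! ### Coordinates and chain rules along graphs -/

theorem partialT_eq_dirDeriv : partialT = dirDeriv (1, 0) := rfl

theorem partialX_eq_dirDeriv : partialX = dirDeriv (0, 1) := rfl

theorem fderiv_apply_eq_partial (f : BaseSpaceTX → ℝ) (p w : BaseSpaceTX) :
    fderiv ℝ f p w = partialT f p * w.1 + partialX f p * w.2 := by
  have : w = w.1 • ((1 : ℝ), (0 : ℝ)) + w.2 • ((0 : ℝ), (1 : ℝ)) := by ext <;> simp
  rw [this, map_add, map_smul, map_smul]
  simp [partialT, partialX, mul_comm]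

/-- The chain rule for `v ∘ (τ, ξ)`. -/
theorem dirDeriv_comp_pair {v τ ξ : BaseSpaceTX → ℝ} {p : BaseSpaceTX}
    (hτ : DifferentiableAt ℝ τ p) (hξ : DifferentiableAt ℝ ξ p)
    (hv : DifferentiableAt ℝ v (τ p, ξ p)) (w : BaseSpaceTX) :
    dirDeriv w (fun q => v (τ q, ξ q)) p
      = partialT v (τ p, ξ p) * dirDeriv w τ p + partialX v (τ p, ξ p) * dirDeriv w ξ p := by
  have h := hv.hasFDerivAt.comp p (hτ.hasFDerivAt.prodMk hξ.hasFDerivAt)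
  change fderiv ℝ (v ∘ fun q => (τ q, ξ q)) p w = _
  rw [h.fderiv, ContinuousLinearMap.comp_apply, fderiv_apply_eq_partial]
  rfl

/-- The chain rule for the restriction of `F` to the graph of `u`. -/
theorem dirDeriv_comp_graph {F : TotalSpaceTXU → ℝ} {u : BaseSpaceTX → ℝ} {p : BaseSpaceTX}
    (hF : DifferentiableAt ℝ F (p, u p)) (hu : DifferentiableAt ℝ u p) (w : BaseSpaceTX) :
    dirDeriv w (fun q => F (q, u q)) p
      = dirDeriv (w, 0) F (p, u p) + dirDeriv ((0, 0), 1) F (p, u p) * dirDeriv w u p := by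
  have h := hF.hasFDerivAt.comp p ((hasFDerivAt_id p).prodMk hu.hasFDerivAt)
  change fderiv ℝ (F ∘ fun q => (id q, u q)) p w = _
  rw [h.fderiv, ContinuousLinearMap.comp_apply]
  have e : ((ContinuousLinearMap.id ℝ BaseSpaceTX).prod (fderiv ℝ u p)) w
      = (w, (0 : ℝ)) + (fderiv ℝ u p w) • (((0 : ℝ), (0 : ℝ)), (1 : ℝ)) := by ext <;> simp
  rw [e, map_add, map_smul]
  simp [dirDeriv, mul_comm]

/-- Second derivatives of `u` occur only in the last term, with factor `F_u`. This makes the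
transformed equation affine in them. -/
theorem dirDeriv_dirDeriv_comp_graph {F : TotalSpaceTXU → ℝ} {u : BaseSpaceTX → ℝ}
    {p : BaseSpaceTX} (hF : ContDiffAt ℝ 2 F (p, u p)) (hu : ContDiffAt ℝ 2 u p)
    (w w' : BaseSpaceTX) :
    dirDeriv w' (dirDeriv w (fun q => F (q, u q))) p
      = dirDeriv (w', 0) (dirDeriv (w, 0) F) (p, u p)
        + dirDeriv ((0, 0), 1) (dirDeriv (w, 0) F) (p, u p) * dirDeriv w' u p
        + dirDeriv ((0, 0), 1) (dirDeriv (w', 0) F) (p, u p) * dirDeriv w u p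
        + dirDeriv ((0, 0), 1) (dirDeriv ((0, 0), 1) F) (p, u p) * dirDeriv w u p * dirDeriv w' u p
        + dirDeriv ((0, 0), 1) F (p, u p) * dirDeriv w' (dirDeriv w u) p := by
  have hFd (v) : DifferentiableAt ℝ (dirDeriv v F) (p, u p) :=
    (hF.dirDeriv (m := 1) (by norm_num) v).differentiableAt (by simp)
  have hud : DifferentiableAt ℝ u p := hu.differentiableAt (by simp)
  have huw : DifferentiableAt ℝ (dirDeriv w u) p :=
    (hu.dirDeriv (m := 1) (by norm_num) w).differentiableAt (by simp)
  have hg : ContinuousAt (fun q => (q, u q)) p := continuousAt_id.prodMk hud.continuousAt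
  have hgd : DifferentiableAt ℝ (fun q => (q, u q)) p := differentiableAt_id.prodMk hud
  have e : dirDeriv w (fun q => F (q, u q)) =ᶠ[𝓝 p] fun q =>
      dirDeriv (w, 0) F (q, u q) + dirDeriv ((0, 0), 1) F (q, u q) * dirDeriv w u q := by
    filter_upwards [hg.eventually (hF.eventually (by simp)), hu.eventually (by simp)] with q h1 h2
    exact dirDeriv_comp_graph (h1.differentiableAt (by simp)) (h2.differentiableAt (by simp)) w
  have hcomp (v) : DifferentiableAt ℝ (fun q => dirDeriv v F (q, u q)) p :=
    DifferentiableAt.comp (f := fun q => (q, u q)) p (hFd v) hgd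
  rw [dirDeriv_congr e, dirDeriv_add (hcomp _) ((hcomp _).fun_mul huw),
    dirDeriv_mul (hcomp _) huw, dirDeriv_comp_graph (hFd _) hud, dirDeriv_comp_graph (hFd _) hud,
    dirDeriv_comm hF (w', 0) ((0, 0), 1)]
  ring

/-! ### The Burgers equation for a parametrized graph -/

/-- The Jacobian determinant `f_t g_x - f_x g_t`. -/
noncomputable def jacobianTX (f g : BaseSpaceTX → ℝ) (p : BaseSpaceTX) : ℝ :=
  partialT f p * partialX g p - partialX f p * partialT g p

theorem differentiableAt_jacobianTX {f g : BaseSpaceTX → ℝ} {p : BaseSpaceTX}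
    (hf : ContDiffAt ℝ 2 f p) (hg : ContDiffAt ℝ 2 g p) :
    DifferentiableAt ℝ (jacobianTX f g) p := by
  have h {f : BaseSpaceTX → ℝ} (hf : ContDiffAt ℝ 2 f p) (v) :
      DifferentiableAt ℝ (dirDeriv v f) p :=
    (hf.dirDeriv (m := 1) (by norm_num) v).differentiableAt (by simp)
  exact ((h hf _).mul (h hg _)).sub ((h hf _).mul (h hg _))

theorem dirDeriv_jacobianTX {f g : BaseSpaceTX → ℝ} {p : BaseSpaceTX}
    (hf : ContDiffAt ℝ 2 f p) (hg : ContDiffAt ℝ 2 g p) (w : BaseSpaceTX) :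
    dirDeriv w (jacobianTX f g) p =
      dirDeriv w (partialT f) p * partialX g p + partialT f p * dirDeriv w (partialX g) p
      - dirDeriv w (partialX f) p * partialT g p - partialX f p * dirDeriv w (partialT g) p := by
  have h {f : BaseSpaceTX → ℝ} (hf : ContDiffAt ℝ 2 f p) (v) :
      DifferentiableAt ℝ (dirDeriv v f) p :=
    (hf.dirDeriv (m := 1) (by norm_num) v).differentiableAt (by simp)
  unfold jacobianTX
  rw [partialT_eq_dirDeriv, partialX_eq_dirDeriv,
    dirDeriv_sub ((h hf _).fun_mul (h hg _)) ((h hf _).fun_mul (h hg _)),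
    dirDeriv_mul (h hf _) (h hg _), dirDeriv_mul (h hf _) (h hg _)]
  ring

/-- The Burgers equation for a function `v`, in terms of a parametrization `(τ, ξ, η)` of the graph
of `v`. -/
theorem satisfiesAt_burgers_iff {τ ξ η v : BaseSpaceTX → ℝ} {p : BaseSpaceTX}
    (hτ : ContDiffAt ℝ 2 τ p) (hξ : ContDiffAt ℝ 2 ξ p)
    (hv : ContDiffAt ℝ 2 v (τ p, ξ p)) (h : η =ᶠ[𝓝 p] fun q => v (τ q, ξ q))
    (hJ : jacobianTX τ ξ p ≠ 0) :
    SatisfiesAt (fun _ => 1) (fun _ => 1) v (τ p, ξ p) ↔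
      jacobianTX τ ξ p ^ 2 * (jacobianTX η ξ p + η p * jacobianTX τ η p)
        = partialT τ p * (jacobianTX τ ξ p * partialX (jacobianTX τ η) p
            - partialX (jacobianTX τ ξ) p * jacobianTX τ η p)
          - partialX τ p * (jacobianTX τ ξ p * partialT (jacobianTX τ η) p
            - partialT (jacobianTX τ ξ) p * jacobianTX τ η p) := by
  have hβ : ContinuousAt (fun q => (τ q, ξ q)) p := hτ.continuousAt.prodMk hξ.continuousAt
  have hτd : DifferentiableAt ℝ τ p := hτ.differentiableAt (by simp)
  have hξd : DifferentiableAt ℝ ξ p := hξ.differentiableAt (by simp)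
  have first : ∀ᶠ q in 𝓝 p, ∀ w, dirDeriv w η q
      = partialT v (τ q, ξ q) * dirDeriv w τ q + partialX v (τ q, ξ q) * dirDeriv w ξ q := by
    filter_upwards [h.eventuallyEq_nhds, hτ.eventually (by simp), hξ.eventually (by simp),
      hβ.eventually (hv.eventually (by simp))] with q h0 h1 h2 h3 w
    rw [dirDeriv_congr h0]
    exact dirDeriv_comp_pair (h1.differentiableAt (by simp)) (h2.differentiableAt (by simp))
      (h3.differentiableAt (by simp)) w
  -- Cramer's rule for `v_x`. It is needed on a neighbourhood, since it is differentiated again to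
  -- reach `v_xx`.
  have hN : jacobianTX τ η =ᶠ[𝓝 p]
      fun q => jacobianTX τ ξ q * partialX v (τ q, ξ q) := by
    filter_upwards [first] with q hq
    have ht := hq (1, 0)
    have hx := hq (0, 1)
    rw [← partialT_eq_dirDeriv] at ht
    rw [← partialX_eq_dirDeriv] at hx
    simp only [jacobianTX, ht, hx]
    ring
  have hvx : DifferentiableAt ℝ (partialX v) (τ p, ξ p) :=
    (hv.dirDeriv (m := 1) (by norm_num) (0, 1)).differentiableAt (by simp)
  have hw : DifferentiableAt ℝ (fun q => partialX v (τ q, ξ q)) p :=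
    DifferentiableAt.comp (f := fun q => (τ q, ξ q)) p hvx (hτd.prodMk hξd)
  have hJd := differentiableAt_jacobianTX hτ hξ
  have second (w) : dirDeriv w (jacobianTX τ η) p = dirDeriv w (jacobianTX τ ξ) p
        * partialX v (τ p, ξ p) + jacobianTX τ ξ p * (partialT (partialX v) (τ p, ξ p)
        * dirDeriv w τ p + partialX (partialX v) (τ p, ξ p) * dirDeriv w ξ p) := by
    rw [dirDeriv_congr hN, dirDeriv_mul hJd hw, dirDeriv_comp_pair hτd hξd hvx]
  have hNt := second (1, 0)
  have hNx := second (0, 1)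
  have ht := first.self_of_nhds (1, 0)
  have hx := first.self_of_nhds (0, 1)
  have hNp := hN.self_of_nhds
  have hηp := h.self_of_nhds
  rw [← partialT_eq_dirDeriv] at ht hNt
  rw [← partialX_eq_dirDeriv] at hx hNx
  have hM : jacobianTX η ξ p = jacobianTX τ ξ p * partialT v (τ p, ξ p) := by
    simp only [jacobianTX, ht, hx]
    ring
  have hJ3 : jacobianTX τ ξ p ^ 3 ≠ 0 := pow_ne_zero 3 hJ
  simp only [] at hNp hηp
  rw [hM, hNp, hNt, hNx, hηp]
  unfold SatisfiesAt
  have hJdef : jacobianTX τ ξ p = partialT τ p * partialX ξ p - partialX τ p * partialT ξ p := rfl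
  generalize jacobianTX τ ξ p = J at *
  constructor
  -- The power `J ^ 3` is the cleared denominator: `v_t` and `v_x` cost one `J` each, `v_xx` costs
  -- three.
  · intro H
    linear_combination J ^ 3 * H + J ^ 2 * partialX (partialX v) (τ p, ξ p) * hJdef
  · intro H
    refine mul_left_cancel₀ hJ3 ?_
    linear_combination H - J ^ 2 * partialX (partialX v) (τ p, ξ p) * hJdef

/-! ### Realizing arbitrary transversal 2-jets -/

theorem bijective_fderiv_of_jacobianTX_ne_zero {τ ξ : BaseSpaceTX → ℝ} {p : BaseSpaceTX}
    (hτ : DifferentiableAt ℝ τ p) (hξ : DifferentiableAt ℝ ξ p) (hJ : jacobianTX τ ξ p ≠ 0) :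
    Function.Bijective (fderiv ℝ (fun q => (τ q, ξ q)) p) := by
  have hinj : Function.Injective (fderiv ℝ (fun q => (τ q, ξ q)) p).toLinearMap := by
    rw [← LinearMap.ker_eq_bot, LinearMap.ker_eq_bot']
    intro w hw
    have hw' : fderiv ℝ (fun q => (τ q, ξ q)) p w = 0 := hw
    rw [(hτ.hasFDerivAt.prodMk hξ.hasFDerivAt).fderiv, ContinuousLinearMap.prod_apply,
      Prod.mk_eq_zero, fderiv_apply_eq_partial, fderiv_apply_eq_partial] at hw'
    obtain ⟨h1, h2⟩ := hw'
    unfold jacobianTX at hJ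
    ext
    · refine mul_left_cancel₀ hJ ?_
      simp only [Prod.fst_zero]
      linear_combination partialX ξ p * h1 - partialX τ p * h2
    · refine mul_left_cancel₀ hJ ?_
      simp only [Prod.snd_zero]
      linear_combination partialT τ p * h2 - partialT ξ p * h1
  exact ⟨hinj, (LinearMap.injective_iff_surjective
    (f := (fderiv ℝ (fun q => (τ q, ξ q)) p).toLinearMap)).1 hinj⟩

/-- By the inverse function theorem the base map has a smooth local inverse `g`, and `v` is the last
component of `Φ` on the graph, composed with `g`. So `Connects` can be tested on every transversal
jet of `u`. -/
theorem exists_mapsGraphAt {W : Set TotalSpaceTXU} {Φ : TotalSpaceTXU → TotalSpaceTXU}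
    (hΦ : IsPointTransformation W Φ) {u : BaseSpaceTX → ℝ} {p : BaseSpaceTX} (hp : (p, u p) ∈ W)
    (hu : ContDiffAt ℝ ∞ u p) (htr : Function.Bijective (fderiv ℝ (baseMap Φ u) p)) :
    ∃ v, MapsGraphAt W Φ u v p := by
  have hΦp : ContDiffAt ℝ ∞ Φ (p, u p) := hΦ.smooth.contDiffAt (hΦ.isOpen.mem_nhds hp)
  have hβ : ContDiffAt ℝ ∞ (baseMap Φ u) p :=
    contDiffAt_fst.comp p (hΦp.comp p (contDiffAt_id.prodMk hu))
  have hβ' : HasFDerivAt (baseMap Φ u) ((ContinuousLinearEquiv.ofBijective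
      (fderiv ℝ (baseMap Φ u) p) (LinearMap.ker_eq_bot.2 htr.1)
      (LinearMap.range_eq_top.2 htr.2) : BaseSpaceTX ≃L[ℝ] BaseSpaceTX) :
        BaseSpaceTX →L[ℝ] BaseSpaceTX) p := by
    rw [ContinuousLinearEquiv.coe_ofBijective]
    exact (hβ.differentiableAt (by simp)).hasFDerivAt
  have hn : (∞ : ℕ∞ω) ≠ 0 := by simp
  let g := hβ.localInverse hβ' hn
  have hg : ContDiffAt ℝ ∞ g (baseMap Φ u p) := hβ.to_localInverse hβ' hn
  have hgp : g (baseMap Φ u p) = p := hβ.localInverse_apply_image hβ' hn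
  have hleft : ∀ᶠ q in 𝓝 p, g (baseMap Φ u q) = q :=
    (hβ.hasStrictFDerivAt' hβ' hn).eventually_left_inverse
  refine ⟨fun y => (Φ (g y, u (g y))).2, hp, hu, ?_, htr, ?_⟩
  · have h2 : ContDiffAt ℝ ∞ (fun q => (Φ (q, u q)).2) (g (baseMap Φ u p)) := by
      rw [hgp]
      exact contDiffAt_snd.comp p (hΦp.comp p (contDiffAt_id.prodMk hu))
    exact h2.comp (baseMap Φ u p) hg
  · filter_upwards [hleft] with q hq
    simp only [hq]

/-- The quadratic polynomial with prescribed 2-jet at `p`. -/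
noncomputable def quadraticJet (p : BaseSpaceTX) (u₀ a b c d e : ℝ) (q : BaseSpaceTX) : ℝ :=
  u₀ + a * (q.1 - p.1) + b * (q.2 - p.2) + c * ((q.1 - p.1) * (q.1 - p.1)) / 2
    + d * ((q.1 - p.1) * (q.2 - p.2)) + e * ((q.2 - p.2) * (q.2 - p.2)) / 2

theorem dirDeriv_coord_fst (w q : BaseSpaceTX) :
    dirDeriv w (fun q : BaseSpaceTX => q.1) q = w.1 := by
  simp [dirDeriv, fderiv_fst]

theorem dirDeriv_coord_snd (w q : BaseSpaceTX) :
    dirDeriv w (fun q : BaseSpaceTX => q.2) q = w.2 := by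
  simp [dirDeriv, fderiv_snd]

section quadraticJet

variable (p : BaseSpaceTX) (u₀ a b c d e : ℝ)

theorem contDiff_quadraticJet : ContDiff ℝ ∞ (quadraticJet p u₀ a b c d e) := by
  unfold quadraticJet
  fun_prop

theorem quadraticJet_self : quadraticJet p u₀ a b c d e p = u₀ := by simp [quadraticJet]

theorem partialT_quadraticJet : partialT (quadraticJet p u₀ a b c d e) =
    fun q => a + c * (q.1 - p.1) + d * (q.2 - p.2) := by
  ext q
  rw [partialT_eq_dirDeriv]
  unfold quadraticJet
  simp (disch := fun_prop) only [div_eq_mul_inv, dirDeriv_add, dirDeriv_mul, dirDeriv_sub,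
    dirDeriv_const, dirDeriv_coord_fst, dirDeriv_coord_snd]
  ring

theorem partialX_quadraticJet : partialX (quadraticJet p u₀ a b c d e) =
    fun q => b + d * (q.1 - p.1) + e * (q.2 - p.2) := by
  ext q
  rw [partialX_eq_dirDeriv]
  unfold quadraticJet
  simp (disch := fun_prop) only [div_eq_mul_inv, dirDeriv_add, dirDeriv_mul, dirDeriv_sub,
    dirDeriv_const, dirDeriv_coord_fst, dirDeriv_coord_snd]
  ring

theorem dirDeriv_partialT_quadraticJet (w : BaseSpaceTX) :
    dirDeriv w (partialT (quadraticJet p u₀ a b c d e)) p = c * w.1 + d * w.2 := by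
  rw [partialT_quadraticJet]
  simp (disch := fun_prop) only [dirDeriv_add, dirDeriv_mul, dirDeriv_sub,
    dirDeriv_const, dirDeriv_coord_fst, dirDeriv_coord_snd]
  ring

theorem dirDeriv_partialX_quadraticJet (w : BaseSpaceTX) :
    dirDeriv w (partialX (quadraticJet p u₀ a b c d e)) p = d * w.1 + e * w.2 := by
  rw [partialX_quadraticJet]
  simp (disch := fun_prop) only [dirDeriv_add, dirDeriv_mul, dirDeriv_sub,
    dirDeriv_const, dirDeriv_coord_fst, dirDeriv_coord_snd]
  ring

end quadraticJet

/-- The relation between the 2-jets of `u` and of the components of `Φ` along the graph of `u`. -/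
theorem satisfiesAt_iff_of_connects {W : Set TotalSpaceTXU} {Φ : TotalSpaceTXU → TotalSpaceTXU}
    {A C : BaseSpaceTX → ℝ} (hΦ : ReducesToBurgers A C W Φ) {τ ξ η u : BaseSpaceTX → ℝ}
    {p : BaseSpaceTX} (hp : (p, u p) ∈ W) (hu : ContDiffAt ℝ ∞ u p)
    (hτ : τ = fun q => (Φ (q, u q)).1.1) (hξ : ξ = fun q => (Φ (q, u q)).1.2)
    (hη : η = fun q => (Φ (q, u q)).2) (hJ : jacobianTX τ ξ p ≠ 0) :
    SatisfiesAt A C u p ↔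
      jacobianTX τ ξ p ^ 2 * (jacobianTX η ξ p + η p * jacobianTX τ η p)
        = partialT τ p * (jacobianTX τ ξ p * partialX (jacobianTX τ η) p
            - partialX (jacobianTX τ ξ) p * jacobianTX τ η p)
          - partialX τ p * (jacobianTX τ ξ p * partialT (jacobianTX τ η) p
            - partialT (jacobianTX τ ξ) p * jacobianTX τ η p) := by
  have hΦp : ContDiffAt ℝ ∞ (fun q => Φ (q, u q)) p :=
    (hΦ.1.smooth.contDiffAt (hΦ.1.isOpen.mem_nhds hp)).comp p (contDiffAt_id.prodMk hu)
  have hτs : ContDiffAt ℝ ∞ τ p := hτ ▸ contDiffAt_fst.comp p (contDiffAt_fst.comp p hΦp)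
  have hξs : ContDiffAt ℝ ∞ ξ p := hξ ▸ contDiffAt_snd.comp p (contDiffAt_fst.comp p hΦp)
  have hβ : baseMap Φ u = fun q => (τ q, ξ q) := by rw [hτ, hξ]; rfl
  have htr : Function.Bijective (fderiv ℝ (baseMap Φ u) p) := by
    rw [hβ]
    exact bijective_fderiv_of_jacobianTX_ne_zero (hτs.differentiableAt (by simp))
      (hξs.differentiableAt (by simp)) hJ
  obtain ⟨v, hv⟩ := exists_mapsGraphAt hΦ.1 hp hu htr
  rw [hΦ.2 u v p hv]
  have hvs := hv.smooth_target
  have hge := hv.graph_eq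
  rw [hβ] at hvs hge ⊢
  have h2 : (2 : ℕ∞ω) ≤ ∞ := ENat.LEInfty.out
  refine satisfiesAt_burgers_iff (hτs.of_le h2) (hξs.of_le h2) (hvs.of_le h2) ?_ hJ
  rw [hη]
  exact hge

local notation "𝐭" => (((1 : ℝ), (0 : ℝ)), (0 : ℝ))
local notation "𝐱" => (((0 : ℝ), (1 : ℝ)), (0 : ℝ))
local notation "𝐮" => (((0 : ℝ), (0 : ℝ)), (1 : ℝ))
local notation "∂t" => dirDeriv 𝐭
local notation "∂x" => dirDeriv 𝐱
local notation "∂u" => dirDeriv 𝐮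


/-! ### The transformed equation as algebra on jets -/

/-- The first and second derivatives of a function of `(t, x)` at a point. -/
@[ext]
structure DerivJet where
  t : ℝ
  x : ℝ
  tt : ℝ
  tx : ℝ
  xx : ℝ

namespace DerivJet

/-- The jet of derivatives of `f` at `p`. -/
noncomputable def of (f : BaseSpaceTX → ℝ) (p : BaseSpaceTX) : DerivJet :=
  ⟨partialT f p, partialX f p, partialT (partialT f) p, partialT (partialX f) p,
    partialX (partialX f) p⟩

/-- Add a multiple of the second derivatives `c`, `d`, `e`. -/
def addSecond (f : DerivJet) (m c d e : ℝ) : DerivJet :=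
  ⟨f.t, f.x, f.tt + m * c, f.tx + m * d, f.xx + m * e⟩

/-- The value of the determinant `f_t g_x - f_x g_t`. -/
def jac (f g : DerivJet) : ℝ := f.t * g.x - f.x * g.t

/-- The `t`-derivative of the determinant `f_t g_x - f_x g_t`. -/
def jacT (f g : DerivJet) : ℝ := f.tt * g.x + f.t * g.tx - f.tx * g.t - f.x * g.tt

/-- The `x`-derivative of the determinant `f_t g_x - f_x g_t`. -/
def jacX (f g : DerivJet) : ℝ := f.tx * g.x + f.t * g.xx - f.xx * g.t - f.x * g.tx

/-- The Burgers equation for the graph parametrized by functions with jets `τ`, `ξ`, `η`, the last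
one having the value `η₀`. -/
def Burgers (η₀ : ℝ) (τ ξ η : DerivJet) : Prop :=
  jac τ ξ ^ 2 * (jac η ξ + η₀ * jac τ η)
    = τ.t * (jac τ ξ * jacX τ η - jacX τ ξ * jac τ η)
      - τ.x * (jac τ ξ * jacT τ η - jacT τ ξ * jac τ η)

theorem partialT_jacobianTX {f g : BaseSpaceTX → ℝ} {p : BaseSpaceTX}
    (hf : ContDiffAt ℝ 2 f p) (hg : ContDiffAt ℝ 2 g p) :
    partialT (jacobianTX f g) p = jacT (of f p) (of g p) := by
  rw [partialT_eq_dirDeriv, dirDeriv_jacobianTX hf hg]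
  rfl

theorem partialX_jacobianTX {f g : BaseSpaceTX → ℝ} {p : BaseSpaceTX}
    (hf : ContDiffAt ℝ 2 f p) (hg : ContDiffAt ℝ 2 g p) :
    partialX (jacobianTX f g) p = jacX (of f p) (of g p) := by
  rw [partialX_eq_dirDeriv, dirDeriv_jacobianTX hf hg, partialT_eq_dirDeriv, dirDeriv_comm hf,
    dirDeriv_comm hg]
  rfl

theorem burgers_of_iff {τ ξ η : BaseSpaceTX → ℝ} {p : BaseSpaceTX}
    (hτ : ContDiffAt ℝ 2 τ p) (hξ : ContDiffAt ℝ 2 ξ p) (hη : ContDiffAt ℝ 2 η p) :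
    Burgers (η p) (of τ p) (of ξ p) (of η p) ↔
      jacobianTX τ ξ p ^ 2 * (jacobianTX η ξ p + η p * jacobianTX τ η p)
        = partialT τ p * (jacobianTX τ ξ p * partialX (jacobianTX τ η) p
            - partialX (jacobianTX τ ξ) p * jacobianTX τ η p)
          - partialX τ p * (jacobianTX τ ξ p * partialT (jacobianTX τ η) p
            - partialT (jacobianTX τ ξ) p * jacobianTX τ η p) := by
  rw [partialT_jacobianTX hτ hη, partialT_jacobianTX hτ hξ, partialX_jacobianTX hτ hη,
    partialX_jacobianTX hτ hξ]
  rfl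

/-- If the Burgers equation, as an equation for the second derivatives `c`, `d`, `e`, is equivalent to
prescribing the value of `e`, then the new time does not depend on the old position. -/
theorem x_eq_zero_of_burgers_iff {η₀ k A τu ξu ηu : ℝ} {τ ξ η : DerivJet} (hA : A ≠ 0)
    (H : ∀ c d e : ℝ, k = A * e ↔ Burgers η₀ (τ.addSecond τu c d e) (ξ.addSecond ξu c d e)
      (η.addSecond ηu c d e)) : τ.x = 0 := by
  obtain ⟨e₀, rfl⟩ : ∃ e₀, A * e₀ = k := ⟨k / A, by field_simp⟩
  have H0 := (H 0 0 e₀).1 rfl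
  have H1 := (H 1 0 e₀).1 rfl
  have H2 := (H 0 1 e₀).1 rfl
  -- `Burgers` is affine in `c, d, e`. It holds for every `c, d` when `e = e₀`, but fails at `e₀ +
  -- 1`, so its `e`-coefficient is nonzero.
  have H3 := mt (H 0 0 (e₀ + 1)).2 (fun h => by
    have := mul_left_cancel₀ hA h
    linarith)
  by_contra hx
  simp only [Burgers, addSecond, jac, jacT, jacX] at H0 H1 H2 H3
  -- The coefficient of `c` vanishes; next, so does that of `d`. If `τ.x ≠ 0`, the brackets vanish,
  -- and the second of them times `τ.t` is, up to sign, the `e`-coefficient, contradicting `H3`.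
  have g1 : τ.x * ((τ.t * ξ.x - τ.x * ξ.t) * (τu * η.x - τ.x * ηu)
      - (τ.t * η.x - τ.x * η.t) * (τu * ξ.x - τ.x * ξu)) = 0 := by
    linear_combination H1 - H0
  have g1' := (mul_eq_zero.1 g1).resolve_left hx
  have g2 : τ.x * ((τ.t * ξ.x - τ.x * ξ.t) * (τ.t * ηu - τu * η.t)
      - (τ.t * η.x - τ.x * η.t) * (τ.t * ξu - τu * ξ.t)) = 0 := by
    linear_combination H2 - H0 + τ.t * g1'
  have g2' := (mul_eq_zero.1 g2).resolve_left hx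
  apply H3
  linear_combination H0 - τ.t * g2'

end DerivJet

/-- The jet of derivatives of `F (t, x, u(t, x))` at `z` if `a`, `b` are the first derivatives of `u`,
with the terms containing second derivatives of `u` left out. -/
noncomputable def graphJet (F : TotalSpaceTXU → ℝ) (z : TotalSpaceTXU) (a b : ℝ) : DerivJet where
  t := ∂t F z + ∂u F z * a
  x := ∂x F z + ∂u F z * b
  tt := ∂t (∂t F) z + 2 * ∂u (∂t F) z * a + ∂u (∂u F) z * a * a
  tx := ∂t (∂x F) z + ∂u (∂x F) z * a + ∂u (∂t F) z * b + ∂u (∂u F) z * b * a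
  xx := ∂x (∂x F) z + 2 * ∂u (∂x F) z * b + ∂u (∂u F) z * b * b

theorem derivJet_of_comp_graph {F : TotalSpaceTXU → ℝ} {u : BaseSpaceTX → ℝ} {p : BaseSpaceTX}
    (hF : ContDiffAt ℝ 2 F (p, u p)) (hu : ContDiffAt ℝ 2 u p) :
    DerivJet.of (fun q => F (q, u q)) p
      = (graphJet F (p, u p) (partialT u p) (partialX u p)).addSecond (∂u F (p, u p))
        (partialT (partialT u) p) (partialT (partialX u) p) (partialX (partialX u) p) := by
  have hFd := hF.differentiableAt (by simp)
  have hud := hu.differentiableAt (by simp)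
  ext
  · exact dirDeriv_comp_graph hFd hud _
  · exact dirDeriv_comp_graph hFd hud _
  · refine (dirDeriv_dirDeriv_comp_graph hF hu (1, 0) (1, 0)).trans ?_
    simp only [DerivJet.addSecond, graphJet, partialT_eq_dirDeriv]
    ring
  · refine (dirDeriv_dirDeriv_comp_graph hF hu (0, 1) (1, 0)).trans ?_
    simp only [DerivJet.addSecond, graphJet, partialT_eq_dirDeriv, partialX_eq_dirDeriv]
  · refine (dirDeriv_dirDeriv_comp_graph hF hu (0, 1) (0, 1)).trans ?_
    simp only [DerivJet.addSecond, graphJet, partialX_eq_dirDeriv]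
    ring

section Necessity

variable {W : Set TotalSpaceTXU} {T X U : TotalSpaceTXU → ℝ} {A C : BaseSpaceTX → ℝ}

/-- The equivalence of the two equations, for the 2-jet with the coordinates
`z, a, b, c, d, e = (t, x, u), u_t, u_x, u_tt, u_tx, u_xx`. -/
theorem burgers_graphJet_iff (hΦ : ReducesToBurgers A C W fun z => ((T z, X z), U z))
    {z : TotalSpaceTXU} (hz : z ∈ W) (a b c d e : ℝ)
    (hJ : DerivJet.jac (graphJet T z a b) (graphJet X z a b) ≠ 0) :
    a + C z.1 * z.2 * b = A z.1 * e ↔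
      DerivJet.Burgers (U z) ((graphJet T z a b).addSecond (∂u T z) c d e)
        ((graphJet X z a b).addSecond (∂u X z) c d e)
        ((graphJet U z a b).addSecond (∂u U z) c d e) := by
  obtain ⟨p, u₀⟩ := z
  set u := quadraticJet p u₀ a b c d e with hu
  have hup : u p = u₀ := quadraticJet_self p u₀ a b c d e
  have hus : ContDiffAt ℝ ∞ u p := (contDiff_quadraticJet p u₀ a b c d e).contDiffAt
  have hpW : (p, u p) ∈ W := by rwa [hup]
  have hΦp : ContDiffAt ℝ ∞ (fun z => ((T z, X z), U z)) (p, u p) :=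
    hΦ.1.smooth.contDiffAt (hΦ.1.isOpen.mem_nhds hpW)
  have h2 : (2 : ℕ∞ω) ≤ ∞ := ENat.LEInfty.out
  have hT : ContDiffAt ℝ 2 T (p, u p) :=
    (contDiffAt_fst.comp _ (contDiffAt_fst.comp _ hΦp)).of_le h2
  have hX : ContDiffAt ℝ 2 X (p, u p) :=
    (contDiffAt_snd.comp _ (contDiffAt_fst.comp _ hΦp)).of_le h2
  have hU : ContDiffAt ℝ 2 U (p, u p) := (contDiffAt_snd.comp _ hΦp).of_le h2
  have hu2 := hus.of_le h2
  have hg : ContDiffAt ℝ 2 (fun q => (q, u q)) p := contDiffAt_id.prodMk hu2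
  have ut : partialT u p = a := by simp [hu, partialT_quadraticJet]
  have ux : partialX u p = b := by simp [hu, partialX_quadraticJet]
  have utt : partialT (partialT u) p = c :=
    (dirDeriv_partialT_quadraticJet p u₀ a b c d e (1, 0)).trans (by simp)
  have utx : partialT (partialX u) p = d :=
    (dirDeriv_partialX_quadraticJet p u₀ a b c d e (1, 0)).trans (by simp)
  have uxx : partialX (partialX u) p = e :=
    (dirDeriv_partialX_quadraticJet p u₀ a b c d e (0, 1)).trans (by simp)
  have jT := derivJet_of_comp_graph hT hu2
  have jX := derivJet_of_comp_graph hX hu2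
  have jU := derivJet_of_comp_graph hU hu2
  rw [ut, ux, utt, utx, uxx, hup] at jT jX jU
  have hJ' : jacobianTX (fun q => T (q, u q)) (fun q => X (q, u q)) p ≠ 0 := by
    change DerivJet.jac (DerivJet.of _ p) (DerivJet.of _ p) ≠ 0
    rw [jT, jX]
    exact hJ
  have key := satisfiesAt_iff_of_connects hΦ (η := fun q => U (q, u q)) hpW hus rfl rfl rfl hJ'
  have hTg : ContDiffAt ℝ 2 (fun q => T (q, u q)) p := hT.comp p hg
  have hXg : ContDiffAt ℝ 2 (fun q => X (q, u q)) p := hX.comp p hg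
  have hUg : ContDiffAt ℝ 2 (fun q => U (q, u q)) p := hU.comp p hg
  rw [← DerivJet.burgers_of_iff hTg hXg hUg, jT, jX, jU,
    SatisfiesAt, ut, ux, uxx, hup] at key
  exact key

end Necessity

/-! ### Consequences of the determining equations -/

theorem dirDeriv_snd (v z : TotalSpaceTXU) :
    dirDeriv v (fun z : TotalSpaceTXU => z.2) z = v.2 := by
  simp [dirDeriv, fderiv_snd]

/-- Consequences of the determining equations of a transformation
`(t, x, u) ↦ (T(t), X(t, x), U(t, x, u))` to the Burgers equation. -/
theorem invariants_of_determining_equations {W : Set TotalSpaceTXU} (hW : IsOpen W)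
    {T X U A C : TotalSpaceTXU → ℝ} (hT : ContDiffOn ℝ ∞ T W) (hX : ContDiffOn ℝ ∞ X W)
    (hU : ContDiffOn ℝ ∞ U W) (hA : ContDiffOn ℝ ∞ A W) (hC : ContDiffOn ℝ ∞ C W)
    (hTx : ∀ z ∈ W, ∂x T z = 0) (hTu : ∀ z ∈ W, ∂u T z = 0) (hXu : ∀ z ∈ W, ∂u X z = 0)
    (hAu : ∀ z ∈ W, ∂u A z = 0) (hCu : ∀ z ∈ W, ∂u C z = 0)
    (hTt : ∀ z ∈ W, ∂t T z ≠ 0) (hXx : ∀ z ∈ W, ∂x X z ≠ 0) (hUu : ∀ z ∈ W, ∂u U z ≠ 0)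
    (hTX : ∀ z ∈ W, ∂t T z = A z * ∂x X z ^ 2) (hUuu : ∀ z ∈ W, ∂u (∂u U) z = 0)
    (h₀ : ∀ z ∈ W, ∂t U z * ∂x X z + ∂x U z * (U z * ∂t T z - ∂t X z + A z * ∂x (∂x X) z)
      = A z * ∂x X z * ∂x (∂x U) z)
    (h₁ : ∀ z ∈ W, ∂u U z * (U z * ∂t T z - ∂t X z + A z * ∂x (∂x X) z)
      - ∂u U z * (C z * z.2 * ∂x X z) = 2 * (A z * ∂x X z * ∂u (∂x U) z)) :
    ∀ z ∈ W, C z = A z * ∂x X z * ∂u U z ∧ ∂x (∂t T) z = 0 ∧ ∂x (∂u U) z = 0 ∧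
      ∂t (fun y => ∂x X y * ∂u U y) z = -∂x (∂x C) z := by
  have sm {f : TotalSpaceTXU → ℝ} (hf : ContDiffOn ℝ ∞ f W) (v : TotalSpaceTXU) :
    ContDiffOn ℝ ∞ (dirDeriv v f) W := hf.dirDeriv hW v
  have df {f : TotalSpaceTXU → ℝ} (hf : ContDiffOn ℝ ∞ f W) {z : TotalSpaceTXU} (hz : z ∈ W) :
    DifferentiableAt ℝ f z := hf.differentiableAt_of_isOpen hW hz
  have comm {f : TotalSpaceTXU → ℝ} (hf : ContDiffOn ℝ ∞ f W) {z : TotalSpaceTXU} (hz : z ∈ W)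
      (v w : TotalSpaceTXU) : dirDeriv v (dirDeriv w f) z = dirDeriv w (dirDeriv v f) z :=
    dirDeriv_comm ((hf.contDiffAt (hW.mem_nhds hz)).of_le ENat.LEInfty.out) v w
  have comm_zero {f : TotalSpaceTXU → ℝ} (hf : ContDiffOn ℝ ∞ f W) {w : TotalSpaceTXU}
      (h : ∀ z ∈ W, dirDeriv w f z = 0) (v : TotalSpaceTXU) :
      ∀ z ∈ W, dirDeriv w (dirDeriv v f) z = 0 := fun z hz => by
    rw [comm hf hz, dirDeriv_eq_zero_on hW h v z hz]
  have hTtu := comm_zero hT hTu 𝐭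
  have hTtx := comm_zero hT hTx 𝐭
  have hXtu := comm_zero hX hXu 𝐭
  have hXxu := comm_zero hX hXu 𝐱
  have hXxxu := comm_zero (sm hX _) hXxu 𝐱
  have hUuxu := comm_zero (sm hU _) hUuu 𝐱
  have hUutu := comm_zero (sm hU _) hUuu 𝐭
  have hUxuu : ∀ z ∈ W, ∂u (∂u (∂x U)) z = 0 := fun z hz => by
    refine Eq.trans ?_ (hUuxu z hz)
    exact dirDeriv_congr_on hW (fun y hy => comm hU hy _ _) _ z hz
  have hUtuu : ∀ z ∈ W, ∂u (∂u (∂t U)) z = 0 := fun z hz => by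
    refine Eq.trans ?_ (hUutu z hz)
    exact dirDeriv_congr_on hW (fun y hy => comm hU hy _ _) _ z hz
  have hUxxuu : ∀ z ∈ W, ∂u (∂u (∂x (∂x U))) z = 0 := fun z hz => by
    refine Eq.trans ?_ (comm_zero (sm (sm hU _) _) hUxuu 𝐱 z hz)
    exact dirDeriv_congr_on hW (fun y hy => comm (sm hU _) hy _ _) _ z hz
  -- the factor multiplying `∂x U` in the second equation
  have hRu : ∀ z ∈ W, ∂u (fun z => U z * ∂t T z - ∂t X z + A z * ∂x (∂x X) z) z
      = ∂u U z * ∂t T z := fun z hz => by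
    have d1 := df hU hz
    have d2 := df (sm hT 𝐭) hz
    have d3 := df (sm hX 𝐭) hz
    have d4 := df hA hz
    have d5 := df (sm (sm hX 𝐱) 𝐱) hz
    simp (disch := fun_prop) only [dirDeriv_add, dirDeriv_mul, dirDeriv_sub]
    rw [hTtu z hz, hXtu z hz, hXxxu z hz, hAu z hz]
    ring
  have hR : ContDiffOn ℝ ∞ (fun z => U z * ∂t T z - ∂t X z + A z * ∂x (∂x X) z) W :=
    ((hU.mul (sm hT _)).sub (sm hX _)).add (hA.mul (sm (sm hX _) _))
  generalize hRdef : (fun z => U z * ∂t T z - ∂t X z + A z * ∂x (∂x X) z) = R at hRu hR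
  have hRz (z) : U z * ∂t T z - ∂t X z + A z * ∂x (∂x X) z = R z := congrFun hRdef z
  simp only [hRz] at h₀ h₁
  -- The `u`-derivative of `h₁`: because `U_uu = 0`, only the explicit `u` and the `U` inside `R`
  -- contribute.
  have hCX : ∀ z ∈ W, C z * ∂x X z = ∂t T z * ∂u U z := fun z hz => by
    have h := dirDeriv_congr_on hW h₁ 𝐮 z hz
    have d1 := df (sm hU 𝐮) hz
    have d2 := df hR hz
    have d3 := df hC hz
    have d4 := df hA hz
    have d5 := df (sm hX 𝐱) hz
    have d6 := df (sm (sm hU 𝐱) 𝐮) hz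
    simp (disch := fun_prop) only [dirDeriv_mul, dirDeriv_sub, dirDeriv_const, dirDeriv_snd] at h
    rw [hUuu z hz, hRu z hz, hCu z hz, hXxu z hz, hAu z hz, hUxuu z hz] at h
    refine mul_left_cancel₀ (hUu z hz) ?_
    linear_combination -h
  have hCA : ∀ z ∈ W, C z = A z * ∂x X z * ∂u U z := fun z hz => by
    refine mul_right_cancel₀ (hXx z hz) ?_
    rw [hCX z hz, hTX z hz]
    ring
  have h₀u : ∀ z ∈ W, ∂u (∂t U) z * ∂x X z + (∂u (∂x U) z * R z + ∂x U z * (∂u U z * ∂t T z))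
      = A z * ∂x X z * ∂u (∂x (∂x U)) z := fun z hz => by
    have h := dirDeriv_congr_on hW h₀ 𝐮 z hz
    have d1 := df (sm hU 𝐭) hz
    have d2 := df hR hz
    have d3 := df (sm hU 𝐱) hz
    have d4 := df hA hz
    have d5 := df (sm hX 𝐱) hz
    have d6 := df (sm (sm hU 𝐱) 𝐱) hz
    simp (disch := fun_prop) only [dirDeriv_add, dirDeriv_mul] at h
    rw [hRu z hz, hXxu z hz, hAu z hz] at h
    linear_combination h
  -- The second `u`-derivative of `h₀`: since `U` is locally affine in `u`, all that survives is `2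
  -- U_xu U_u T_t = 0`.
  have hUxu : ∀ z ∈ W, ∂u (∂x U) z = 0 := fun z hz => by
    have h := dirDeriv_congr_on hW h₀u 𝐮 z hz
    have d1 := df (sm (sm hU 𝐭) 𝐮) hz
    have d2 := df hR hz
    have d3 := df (sm hU 𝐱) hz
    have d4 := df hA hz
    have d5 := df (sm hX 𝐱) hz
    have d6 := df (sm (sm hU 𝐱) 𝐮) hz
    have d7 := df (sm (sm (sm hU 𝐱) 𝐱)
      𝐮) hz
    have d8 := df (sm hU 𝐮) hz
    have d9 := df (sm hT 𝐭) hz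
    simp (disch := fun_prop) only [dirDeriv_add, dirDeriv_mul] at h
    rw [hRu z hz, hXxu z hz, hAu z hz, hUtuu z hz, hUxuu z hz, hUuu z hz, hTtu z hz,
      hUxxuu z hz] at h
    have h' : ∂u (∂x U) z * (2 * (∂u U z * ∂t T z)) = 0 := by linear_combination h
    exact (mul_eq_zero.1 h').resolve_right
      (mul_ne_zero two_ne_zero (mul_ne_zero (hUu z hz) (hTt z hz)))
  have hUux : ∀ z ∈ W, ∂x (∂u U) z = 0 := fun z hz => by rw [comm hU hz, hUxu z hz]
  have hCx : ∀ z ∈ W, A z * ∂x (∂x X) z * ∂u U z = -∂x C z := fun z hz => by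
    have h := dirDeriv_congr_on hW hCX 𝐱 z hz
    have d1 := df hC hz
    have d2 := df (sm hX 𝐱) hz
    have d3 := df (sm hU 𝐮) hz
    have d4 := df (sm hT 𝐭) hz
    simp (disch := fun_prop) only [dirDeriv_mul] at h
    rw [hTtx z hz, hUux z hz] at h
    refine mul_right_cancel₀ (hXx z hz) ?_
    linear_combination h - ∂x (∂x X) z * hCA z hz
  -- With `U_xu = 0` the right side of `h₁` disappears and the equation can be solved for `X_t`.
  have hXt : ∀ z ∈ W, ∂t X z * ∂u U z
      = U z * (∂t T z * ∂u U z) - ∂x C z - z.2 * (∂t T z * ∂u U z * ∂u U z) := fun z hz => by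
    have h := h₁ z hz
    rw [hUxu z hz, ← hRz z] at h
    linear_combination -h + hCx z hz - z.2 * ∂u U z * hCX z hz
  intro z hz
  refine ⟨hCA z hz, hTtx z hz, hUux z hz, ?_⟩
  have h := dirDeriv_congr_on hW hXt 𝐱 z hz
  have d1 := df (sm hX 𝐭) hz
  have d2 := df (sm hX 𝐱) hz
  have d3 := df (sm hU 𝐮) hz
  have d4 := df (sm hT 𝐭) hz
  have d5 := df hU hz
  have d6 := df (sm hC 𝐱) hz
  simp (disch := fun_prop) only [dirDeriv_mul, dirDeriv_sub, dirDeriv_snd] at h ⊢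
  rw [hTtx z hz, hUux z hz] at h
  -- Now `h₀u` reads `U_tu X_x + U_x U_u T_t = 0`, cancelling the `U_x` term in the `x`-derivative
  -- of `hXt` and leaving `-C_xx`.
  have h0 := h₀u z hz
  rw [hUxu z hz, comm (sm hU _) hz, dirDeriv_eq_zero_on hW hUxu _ z hz] at h0
  rw [comm hX hz, comm hU hz]
  linear_combination h + h0

/-! ### Necessity: deriving the determining equations -/

theorem fderiv_apply_eq_dirDeriv (f : TotalSpaceTXU → ℝ) (z w : TotalSpaceTXU) :
    fderiv ℝ f z w = ∂t f z * w.1.1 + ∂x f z * w.1.2 + ∂u f z * w.2 := by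
  have : w = w.1.1 • 𝐭 + w.1.2 • 𝐱 + w.2 • 𝐮 := by ext <;> simp
  rw [this, map_add, map_add, map_smul, map_smul, map_smul]
  simp [dirDeriv, mul_comm]

section Necessity

variable {W : Set TotalSpaceTXU} {T X U : TotalSpaceTXU → ℝ} {A C : BaseSpaceTX → ℝ}

theorem IsPointTransformation.contDiffOn_components
    (hΦ : IsPointTransformation W fun z => ((T z, X z), U z)) :
    ContDiffOn ℝ ∞ T W ∧ ContDiffOn ℝ ∞ X W ∧ ContDiffOn ℝ ∞ U W :=
  ⟨hΦ.smooth.fst.fst, hΦ.smooth.fst.snd, hΦ.smooth.snd⟩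

theorem IsPointTransformation.exists_preimage
    (hΦ : IsPointTransformation W fun z => ((T z, X z), U z)) {z : TotalSpaceTXU} (hz : z ∈ W)
    (r s t : ℝ) : ∃ i j k : ℝ, ∂t T z * i + ∂x T z * j + ∂u T z * k = r ∧
      ∂t X z * i + ∂x X z * j + ∂u X z * k = s ∧ ∂t U z * i + ∂x U z * j + ∂u U z * k = t := by
  obtain ⟨hT, hX, hU⟩ := hΦ.contDiffOn_components
  obtain ⟨w, hw⟩ := (hΦ.bijective_fderiv z hz).2 ((r, s), t)
  have d := ((hT.differentiableAt_of_isOpen hΦ.isOpen hz).hasFDerivAt.prodMk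
    (hX.differentiableAt_of_isOpen hΦ.isOpen hz).hasFDerivAt).prodMk
    (hU.differentiableAt_of_isOpen hΦ.isOpen hz).hasFDerivAt
  rw [d.fderiv] at hw
  simp only [ContinuousLinearMap.prod_apply, Prod.mk.injEq, fderiv_apply_eq_dirDeriv] at hw
  exact ⟨w.1.1, w.1.2, w.2, hw.1.1, hw.1.2, hw.2⟩

/-- The determinant is affine in `(a, b)`, with the 2×2 minors of the derivative of `(T, X)` as
coefficients up to sign. They cannot all vanish, as that derivative has rank two. -/
theorem IsPointTransformation.exists_jac_ne_zero
    (hΦ : IsPointTransformation W fun z => ((T z, X z), U z)) {z : TotalSpaceTXU} (hz : z ∈ W) :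
    ∃ a b, DerivJet.jac (graphJet T z a b) (graphJet X z a b) ≠ 0 := by
  by_contra! h
  obtain ⟨i, j, k, h1, h2, -⟩ := hΦ.exists_preimage hz 1 0 0
  obtain ⟨i', j', k', h1', h2', -⟩ := hΦ.exists_preimage hz 0 1 0
  have e0 := h 0 0
  have e1 := h 1 0
  have e2 := h 0 1
  simp only [DerivJet.jac, graphJet] at e0 e1 e2
  have : (1 : ℝ) = 0 := by
    linear_combination (i * j' - j * i') * e0 + (k * j' - j * k') * (e1 - e0)
      + (i * k' - k * i') * (e2 - e0) - (∂t X z * i' + ∂x X z * j' + ∂u X z * k') * h1 - h2'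
      + (∂t T z * i' + ∂x T z * j' + ∂u T z * k') * h2
  norm_num at this

/-- The new time depends on the old time only. -/
theorem ReducesToBurgers.time_eq_zero (hΦ : ReducesToBurgers A C W fun z => ((T z, X z), U z))
    (hA0 : ∀ z ∈ W, A z.1 ≠ 0) : ∀ z ∈ W, ∂x T z = 0 ∧ ∂u T z = 0 := by
  intro z hz
  have key (a b : ℝ) (hJ : DerivJet.jac (graphJet T z a b) (graphJet X z a b) ≠ 0) :
      ∂x T z + ∂u T z * b = 0 :=
    DerivJet.x_eq_zero_of_burgers_iff (hA0 z hz) fun c d e =>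
      burgers_graphJet_iff hΦ hz a b c d e hJ
  obtain ⟨a, b, hJ⟩ := hΦ.1.exists_jac_ne_zero hz
  have h0 := key a b hJ
  have hu : ∂u T z = 0 := by
    -- For fixed `a` the determinant is affine in `b`, so it cannot vanish at both `b + 1` and `b -
    -- 1`. A second admissible slope separates `T_u` from `T_x`.
    by_cases h1 : DerivJet.jac (graphJet T z a (b + 1)) (graphJet X z a (b + 1)) = 0
    · have h2 : DerivJet.jac (graphJet T z a (b - 1)) (graphJet X z a (b - 1)) ≠ 0 := by
        intro h2
        apply hJ
        simp only [DerivJet.jac, graphJet] at h1 h2 ⊢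
        linear_combination (h1 + h2) / 2
      linear_combination h0 - key a (b - 1) h2
    · linear_combination key a (b + 1) h1 - h0
  exact ⟨by rw [hu] at h0; linear_combination h0, hu⟩

theorem ReducesToBurgers.time_deriv_ne_zero
    (hΦ : ReducesToBurgers A C W fun z => ((T z, X z), U z)) (hA0 : ∀ z ∈ W, A z.1 ≠ 0)
    {z : TotalSpaceTXU} (hz : z ∈ W) : ∂t T z ≠ 0 := by
  intro h
  obtain ⟨i, j, k, h1, -, -⟩ := hΦ.1.exists_preimage hz 1 0 0
  rw [h, (hΦ.time_eq_zero hA0 z hz).1, (hΦ.time_eq_zero hA0 z hz).2] at h1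
  norm_num at h1

/-- Since `T_x = T_u = 0`, this minor is, up to sign, the Jacobian determinant of `Φ` divided by
`T_t`. -/
theorem ReducesToBurgers.minor_ne_zero
    (hΦ : ReducesToBurgers A C W fun z => ((T z, X z), U z)) (hA0 : ∀ z ∈ W, A z.1 ≠ 0)
    {z : TotalSpaceTXU} (hz : z ∈ W) : ∂u U z * ∂x X z - ∂u X z * ∂x U z ≠ 0 := by
  intro h
  obtain ⟨i, j, k, h1, h2, h3⟩ := hΦ.1.exists_preimage hz 0 1 0
  obtain ⟨i', j', k', h1', h2', h3'⟩ := hΦ.1.exists_preimage hz 0 0 1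
  have ht := hΦ.time_deriv_ne_zero hA0 hz
  rw [(hΦ.time_eq_zero hA0 z hz).1, (hΦ.time_eq_zero hA0 z hz).2, zero_mul, zero_mul, add_zero,
    add_zero] at h1 h1'
  obtain rfl := (mul_eq_zero.1 h1).resolve_left ht
  obtain rfl := (mul_eq_zero.1 h1').resolve_left ht
  have : (1 : ℝ) = 0 := by
    linear_combination (j * k' - k * j') * h - (∂x U z * j' + ∂u U z * k') * h2 - h3'
      + (∂x X z * j' + ∂u X z * k') * h3
  norm_num at this

/-- The equation for a transformation whose time component depends on time only. -/
theorem ReducesToBurgers.reduced_equation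
    (hΦ : ReducesToBurgers A C W fun z => ((T z, X z), U z)) (hA0 : ∀ z ∈ W, A z.1 ≠ 0)
    {z : TotalSpaceTXU} (hz : z ∈ W) (a b e : ℝ) (he : a + C z.1 * z.2 * b = A z.1 * e)
    (hξ : ∂x X z + ∂u X z * b ≠ 0) :
    (∂x X z + ∂u X z * b) ^ 2 * ((∂t U z + ∂u U z * a) * (∂x X z + ∂u X z * b)
        - (∂x U z + ∂u U z * b) * (∂t X z + ∂u X z * a)
        + U z * ∂t T z * (∂x U z + ∂u U z * b))
      = ∂t T z * ((∂x X z + ∂u X z * b) * (∂x (∂x U) z + 2 * ∂u (∂x U) z * b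
          + ∂u (∂u U) z * b * b + ∂u U z * e)
        - (∂x (∂x X) z + 2 * ∂u (∂x X) z * b + ∂u (∂u X) z * b * b + ∂u X z * e)
          * (∂x U z + ∂u U z * b)) := by
  have hW := hΦ.1.isOpen
  have hTs := hΦ.1.contDiffOn_components.1
  have hTx : ∀ z ∈ W, ∂x T z = 0 := fun z hz => (hΦ.time_eq_zero hA0 z hz).1
  have hTu : ∀ z ∈ W, ∂u T z = 0 := fun z hz => (hΦ.time_eq_zero hA0 z hz).2
  have hTt := hΦ.time_deriv_ne_zero hA0 hz
  have hTut : ∂u (∂t T) z = 0 := by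
    rw [dirDeriv_comm ((hTs.contDiffAt (hW.mem_nhds hz)).of_le ENat.LEInfty.out),
      dirDeriv_eq_zero_on hW hTu _ z hz]
  have hJ : DerivJet.jac (graphJet T z a b) (graphJet X z a b) ≠ 0 := by
    simp only [DerivJet.jac, graphJet, hTx z hz, hTu z hz, zero_mul, add_zero, sub_zero]
    exact mul_ne_zero hTt hξ
  -- With `T_x = T_u = 0`, the coefficients of `u_tt` and `u_tx` vanish, so setting both to `0`
  -- loses nothing.
  have key := (burgers_graphJet_iff hΦ hz a b 0 0 e hJ).1 he
  simp only [DerivJet.Burgers, DerivJet.jac, DerivJet.jacX, DerivJet.jacT, DerivJet.addSecond,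
    graphJet, hTx z hz, hTu z hz, hTut, dirDeriv_eq_zero_on hW hTx _ z hz,
    dirDeriv_eq_zero_on hW hTu _ z hz] at key
  refine mul_left_cancel₀ (pow_ne_zero 2 hTt) ?_
  linear_combination key

/-- On (1), raising `u_t` by `1` raises `u_xx` by `1 / A`. The difference of the two transformed
equations gives `T_t = A (X_x + X_u b)^2` for every admissible slope `b`, which forces `X_u = 0`. -/
theorem ReducesToBurgers.space_determining_equations
    (hΦ : ReducesToBurgers A C W fun z => ((T z, X z), U z)) (hA0 : ∀ z ∈ W, A z.1 ≠ 0)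
    {z : TotalSpaceTXU} (hz : z ∈ W) : ∂u X z = 0 ∧ ∂t T z = A z.1 * ∂x X z ^ 2 := by
  have hA := hA0 z hz
  have hTt := hΦ.time_deriv_ne_zero hA0 hz
  have hΔ := hΦ.minor_ne_zero hA0 hz
  have key (b : ℝ) (hξ : ∂x X z + ∂u X z * b ≠ 0) :
      ∂t T z = A z.1 * (∂x X z + ∂u X z * b) ^ 2 := by
    have h0 := hΦ.reduced_equation hA0 hz 0 b (C z.1 * z.2 * b / A z.1) (by field_simp; ring) hξ
    have h1 := hΦ.reduced_equation hA0 hz 1 b (C z.1 * z.2 * b / A z.1 + 1 / A z.1)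
      (by field_simp; ring) hξ
    have hAi : A z.1 * (1 / A z.1) = 1 := by field_simp
    generalize 1 / A z.1 = i at h1 hAi
    refine mul_left_cancel₀ hΔ ?_
    linear_combination -A z.1 * (h1 - h0)
      - (∂u U z * ∂x X z - ∂u X z * ∂x U z) * ∂t T z * hAi
  have hXu : ∂u X z = 0 := by
    by_contra hXu
    -- These slopes make `X_x + X_u b` equal to `1` and `2`, so `T_t = A = 4A`.
    have h1 := key ((1 - ∂x X z) / ∂u X z) (by field_simp; norm_num)
    have h2 := key ((2 - ∂x X z) / ∂u X z) (by field_simp; norm_num)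
    field_simp at h1 h2
    apply hA
    linear_combination (h1 - h2) / 3
  refine ⟨hXu, ?_⟩
  have hXx : ∂x X z ≠ 0 := fun h => hΔ (by rw [h, hXu]; ring)
  simpa [hXu] using key 0 (by simpa using hXx)

/-- On jets with `u_xx = 0` and `u_t = -C u u_x`, the reduced equation is a quadratic polynomial
identity in `b = u_x`; the three conclusions are its coefficients, read off at `b = 0, 1, -1`. -/
theorem ReducesToBurgers.value_determining_equations
    (hΦ : ReducesToBurgers A C W fun z => ((T z, X z), U z)) (hA0 : ∀ z ∈ W, A z.1 ≠ 0)
    {z : TotalSpaceTXU} (hz : z ∈ W) : ∂u (∂u U) z = 0 ∧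
      ∂t U z * ∂x X z + ∂x U z * (U z * ∂t T z - ∂t X z + A z.1 * ∂x (∂x X) z)
        = A z.1 * ∂x X z * ∂x (∂x U) z ∧
      ∂u U z * (U z * ∂t T z - ∂t X z + A z.1 * ∂x (∂x X) z)
        - ∂u U z * (C z.1 * z.2 * ∂x X z) = 2 * (A z.1 * ∂x X z * ∂u (∂x U) z) := by
  have hW := hΦ.1.isOpen
  have hXs := hΦ.1.contDiffOn_components.2.1
  have hA := hA0 z hz
  have hΔ := hΦ.minor_ne_zero hA0 hz
  have hXu : ∀ z ∈ W, ∂u X z = 0 := fun z hz => (hΦ.space_determining_equations hA0 hz).1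
  have hTX := (hΦ.space_determining_equations hA0 hz).2
  have hXx : ∂x X z ≠ 0 := fun h => hΔ (by rw [h, hXu z hz]; ring)
  have hXux : ∂u (∂x X) z = 0 := by
    rw [dirDeriv_comm ((hXs.contDiffAt (hW.mem_nhds hz)).of_le ENat.LEInfty.out),
      dirDeriv_eq_zero_on hW hXu _ z hz]
  have key (b : ℝ) : (∂t U z - ∂u U z * (C z.1 * z.2 * b)) * ∂x X z
      + (∂x U z + ∂u U z * b) * (U z * ∂t T z - ∂t X z + A z.1 * ∂x (∂x X) z)
      = A z.1 * ∂x X z * (∂x (∂x U) z + 2 * ∂u (∂x U) z * b + ∂u (∂u U) z * b * b) := by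
    have h := hΦ.reduced_equation hA0 hz (-(C z.1 * z.2 * b)) b 0 (by ring)
      (by rw [hXu z hz]; simpa using hXx)
    rw [hXu z hz, hXux, dirDeriv_eq_zero_on hW hXu _ z hz] at h
    refine mul_left_cancel₀ (pow_ne_zero 2 hXx) ?_
    linear_combination h + (∂x X z * (∂x (∂x U) z + 2 * ∂u (∂x U) z * b + ∂u (∂u U) z * b * b)
      - ∂x (∂x X) z * (∂x U z + ∂u U z * b)) * hTX
  have k0 := key 0
  have k1 := key 1
  have k2 := key (-1)
  refine ⟨?_, ?_, ?_⟩
  · refine mul_left_cancel₀ (mul_ne_zero hA hXx) ?_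
    linear_combination k0 - (k1 + k2) / 2
  · linear_combination k0
  · linear_combination (k1 - k2) / 2

end Necessity

theorem dirDeriv_comp_fst {f : BaseSpaceTX → ℝ} {z : TotalSpaceTXU}
    (hf : DifferentiableAt ℝ f z.1) (v : TotalSpaceTXU) :
    dirDeriv v (fun z : TotalSpaceTXU => f z.1) z = dirDeriv v.1 f z.1 := by
  have h : HasFDerivAt (fun z : TotalSpaceTXU => f z.1) _ z := hf.hasFDerivAt.comp z hasFDerivAt_fst
  simp only [dirDeriv, h.fderiv]
  rfl

/-- The constraints are necessary. -/
theorem ReducibleOver.burgersConstraints {A C : BaseSpaceTX → ℝ} {V : Set BaseSpaceTX}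
    (hA : ContDiffOn ℝ ∞ A V) (hC : ContDiffOn ℝ ∞ C V)
    (hA0 : ∀ p ∈ V, A p ≠ 0) (h : ReducibleOver A C V) :
    BurgersConstraints A C V := by
  obtain ⟨W, Φ, rfl, hΦ⟩ := h
  obtain ⟨T, hTdef⟩ : ∃ T : TotalSpaceTXU → ℝ, T = fun z => (Φ z).1.1 := ⟨_, rfl⟩
  obtain ⟨X, hXdef⟩ : ∃ X : TotalSpaceTXU → ℝ, X = fun z => (Φ z).1.2 := ⟨_, rfl⟩
  obtain ⟨U, hUdef⟩ : ∃ U : TotalSpaceTXU → ℝ, U = fun z => (Φ z).2 := ⟨_, rfl⟩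
  obtain rfl : Φ = fun z => ((T z, X z), U z) := by rw [hTdef, hXdef, hUdef]
  clear hTdef hXdef hUdef
  have hW := hΦ.1.isOpen
  have hV : IsOpen (Prod.fst '' W) := isOpenMap_fst W hW
  have mem {z : TotalSpaceTXU} (hz : z ∈ W) : z.1 ∈ Prod.fst '' W := Set.mem_image_of_mem _ hz
  have hA0' : ∀ z ∈ W, A z.1 ≠ 0 := fun z hz => hA0 _ (mem hz)
  obtain ⟨hT, hX, hU⟩ := hΦ.1.contDiffOn_components
  have hAd {p : BaseSpaceTX} (hp : p ∈ Prod.fst '' W) := hA.differentiableAt_of_isOpen hV hp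
  have hCd {p : BaseSpaceTX} (hp : p ∈ Prod.fst '' W) := hC.differentiableAt_of_isOpen hV hp
  have hXu : ∀ z ∈ W, ∂u X z = 0 := fun z hz => (hΦ.space_determining_equations hA0' hz).1
  have hTX : ∀ z ∈ W, ∂t T z = A z.1 * ∂x X z ^ 2 :=
    fun z hz => (hΦ.space_determining_equations hA0' hz).2
  have inv := invariants_of_determining_equations hW hT hX hU
    (hA.comp contDiffOn_fst fun z hz => mem hz) (hC.comp contDiffOn_fst fun z hz => mem hz)
    (fun z hz => (hΦ.time_eq_zero hA0' z hz).1) (fun z hz => (hΦ.time_eq_zero hA0' z hz).2) hXu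
    (fun z hz => (dirDeriv_comp_fst (hAd (mem hz)) _).trans (map_zero _))
    (fun z hz => (dirDeriv_comp_fst (hCd (mem hz)) _).trans (map_zero _))
    (fun z hz => hΦ.time_deriv_ne_zero hA0' hz)
    (fun z hz h => hΦ.minor_ne_zero hA0' hz (by rw [h, hXu z hz]; ring))
    (fun z hz h => hΦ.minor_ne_zero hA0' hz (by rw [h, hXu z hz]; ring))
    hTX (fun z hz => (hΦ.value_determining_equations hA0' hz).1)
    (fun z hz => (hΦ.value_determining_equations hA0' hz).2.1)
    (fun z hz => (hΦ.value_determining_equations hA0' hz).2.2)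
  have hCX : ∀ z ∈ W, C z.1 = A z.1 * ∂x X z * ∂u U z := fun z hz => (inv z hz).1
  rintro _ ⟨z, hz, rfl⟩
  obtain ⟨-, hTtx, hUux, hC2⟩ := inv z hz
  constructor
  · have e : ∀ y ∈ W, C y.1 ^ 2 / A y.1 = ∂t T y * (∂u U y * ∂u U y) := fun y hy => by
      rw [hTX y hy, div_eq_iff (hA0' y hy), hCX y hy]
      ring
    have hd : DifferentiableAt ℝ (fun q => C q ^ 2 / A q) z.1 :=
      ((hC.pow 2).div hA hA0).differentiableAt_of_isOpen hV (mem hz)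
    have d1 := (hT.dirDeriv hW 𝐭).differentiableAt_of_isOpen hW hz
    have d2 := (hU.dirDeriv hW 𝐮).differentiableAt_of_isOpen hW hz
    have h1 := dirDeriv_comp_fst hd 𝐱
    rw [dirDeriv_congr_on hW e _ z hz] at h1
    simp (disch := fun_prop) only [dirDeriv_mul] at h1
    rw [hTtx, hUux] at h1
    rw [partialX_eq_dirDeriv, ← h1]
    ring
  · have e : ∀ y ∈ W, C y.1 / A y.1 = ∂x X y * ∂u U y := fun y hy => by
      rw [div_eq_iff (hA0' y hy), hCX y hy]
      ring
    have hd : DifferentiableAt ℝ (fun q => C q / A q) z.1 :=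
      (hC.div hA hA0).differentiableAt_of_isOpen hV (mem hz)
    have h1 := dirDeriv_comp_fst hd 𝐭
    rw [dirDeriv_congr_on hW e _ z hz, hC2] at h1
    rw [partialT_eq_dirDeriv, ← h1, neg_inj]
    have hCx : ∀ y ∈ W, ∂x (fun y => C y.1) y = partialX C y.1 :=
      fun y hy => dirDeriv_comp_fst (hCd (mem hy)) 𝐱
    exact (dirDeriv_congr_on hW hCx 𝐱 z hz).trans
      (dirDeriv_comp_fst ((hC.dirDeriv hV (0, 1)).differentiableAt_of_isOpen hV (mem hz)) 𝐱)

/-! ### Integration on convex sets -/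

theorem injOn_of_deriv_ne_zero {s : Set ℝ} (hs : Convex ℝ s) {f : ℝ → ℝ}
    (hf : ∀ x ∈ s, deriv f x ≠ 0) : Set.InjOn f s := by
  have key : ∀ x ∈ s, ∀ y ∈ s, x < y → f x ≠ f y := fun x hx y hy hxy h => by
    have hsub : Set.Icc x y ⊆ s := hs.ordConnected.out hx hy
    obtain ⟨c, hc, hc0⟩ := exists_deriv_eq_zero hxy (fun c hc =>
      (differentiableAt_of_deriv_ne_zero (hf c (hsub hc))).continuousAt.continuousWithinAt) h
    exact hf c (hsub (Set.Ioo_subset_Icc_self hc)) hc0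
  intro x hx y hy h
  rcases lt_trichotomy x y with hxy | hxy | hxy
  · exact absurd h (key x hx y hy hxy)
  · exact hxy
  · exact absurd h.symm (key y hy x hx hxy)

theorem hasDerivAt_slice {f : BaseSpaceTX → ℝ} {p : BaseSpaceTX} (hf : DifferentiableAt ℝ f p) :
    HasDerivAt (fun x => f (p.1, x)) (partialX f p) p.2 :=
  HasFDerivAt.comp_hasDerivAt p.2 (f := fun x => (p.1, x)) (by exact hf.hasFDerivAt)
    ((hasDerivAt_const p.2 p.1).prodMk (hasDerivAt_id p.2))

theorem convex_slice {V : Set BaseSpaceTX} (hV : Convex ℝ V) (t : ℝ) :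
    Convex ℝ {x | (t, x) ∈ V} := by
  intro x hx y hy a b ha hb hab
  have h := hV hx hy ha hb hab
  have e : a • (t, x) + b • (t, y) = (t, a • x + b • y) := by
    ext
    · simp only [Prod.fst_add, Prod.smul_fst, smul_eq_mul]
      rw [← add_mul, hab, one_mul]
    · simp
  rwa [e] at h

theorem eq_of_partialX_eq_zero {V : Set BaseSpaceTX} (hVo : IsOpen V) (hV : Convex ℝ V)
    {f : BaseSpaceTX → ℝ} (hf : ContDiffOn ℝ ∞ f V) (h0 : ∀ p ∈ V, partialX f p = 0) {t x y : ℝ}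
    (hx : (t, x) ∈ V) (hy : (t, y) ∈ V) : f (t, x) = f (t, y) := by
  refine (convex_slice hV t).is_const_of_fderivWithin_eq_zero (𝕜 := ℝ) (f := fun x => f (t, x))
    (fun z hz => ?_) (fun z hz => ?_) hx hy
  · exact (hasDerivAt_slice (p := (t, z)) (hf.differentiableAt_of_isOpen hVo hz)
      ).differentiableAt.differentiableWithinAt
  · have hd := hasDerivAt_slice (p := (t, z)) (hf.differentiableAt_of_isOpen hVo hz)
    have ho : IsOpen {x | (t, x) ∈ V} := hVo.preimage (by fun_prop)
    rw [fderivWithin_of_isOpen ho hz]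
    rw [h0 _ hz] at hd
    ext
    simpa using hd.deriv

/-- A function whose `x`-derivative vanishes on an open convex set has a primitive with respect to
`t` that depends on `t` only. -/
theorem exists_time_primitive {V : Set BaseSpaceTX} (hVo : IsOpen V) (hV : Convex ℝ V)
    {f : BaseSpaceTX → ℝ} (hf : ContDiffOn ℝ ∞ f V) (h0 : ∀ p ∈ V, partialX f p = 0) :
    ∃ T : ℝ → ℝ, ContDiffOn ℝ ∞ T (Prod.fst '' V) ∧ ∀ p ∈ V, HasDerivAt T (f p) p.1 := by
  have hSo : IsOpen (Prod.fst '' V) := isOpenMap_fst V hVo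
  have hS : Convex ℝ (Prod.fst '' V) := hV.linear_image (LinearMap.fst ℝ ℝ ℝ)
  have hex : ∀ t : ℝ, ∃ x : ℝ, t ∈ Prod.fst '' V → (t, x) ∈ V := fun t => by
    by_cases h : t ∈ Prod.fst '' V
    · obtain ⟨p, hp, rfl⟩ := h
      exact ⟨p.2, fun _ => hp⟩
    · exact ⟨0, fun h' => absurd h' h⟩
  choose x hx using hex
  have hg : ∀ p ∈ V, f (p.1, x p.1) = f p := fun p hp =>
    eq_of_partialX_eq_zero hVo hV hf h0 (hx p.1 ⟨p, hp, rfl⟩) hp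
  -- The choice `x t` may be discontinuous, but near `p.1` it can be replaced by the constant `p.2`
  -- without changing the value of `f`.
  have hgs : ContDiffOn ℝ ∞ (fun t => f (t, x t)) (Prod.fst '' V) := by
    rintro _ ⟨p, hp, rfl⟩
    have hline : ContDiffAt ℝ ∞ (fun t : ℝ => (t, p.2)) p.1 := contDiffAt_id.prodMk contDiffAt_const
    have h1 : ContDiffAt ℝ ∞ (fun t => f (t, p.2)) p.1 :=
      ContDiffAt.comp p.1 (f := fun t : ℝ => (t, p.2)) (hf.contDiffAt (hVo.mem_nhds hp)) hline
    refine (h1.congr_of_eventuallyEq ?_).contDiffWithinAt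
    filter_upwards [hline.continuousAt.preimage_mem_nhds (hVo.mem_nhds hp)] with t ht
    exact hg (t, p.2) ht
  obtain ⟨T, hT⟩ := hS.exists_forall_hasDerivWithinAt (𝕜 := ℝ)
    (hgs.differentiableOn (by simp))
  have hT' : ∀ t ∈ Prod.fst '' V, HasDerivAt T (f (t, x t)) t := fun t ht =>
    (hT t ht).hasDerivAt (hSo.mem_nhds ht)
  refine ⟨T, (contDiffOn_infty_iff_deriv_of_isOpen hSo).2
    ⟨fun t ht => (hT' t ht).differentiableAt.differentiableWithinAt,
      hgs.congr fun t ht => (hT' t ht).deriv⟩, fun p hp => ?_⟩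
  rw [← hg p hp]
  exact hT' p.1 ⟨p, hp, rfl⟩

/-- The Poincaré lemma in the plane. -/
theorem exists_potential {V : Set BaseSpaceTX} (hVo : IsOpen V) (hV : Convex ℝ V)
    {f g : BaseSpaceTX → ℝ} (hf : ContDiffOn ℝ ∞ f V) (hg : ContDiffOn ℝ ∞ g V)
    (h : ∀ p ∈ V, partialT g p = partialX f p) :
    ∃ X : BaseSpaceTX → ℝ, ContDiffOn ℝ ∞ X V ∧
      ∀ p ∈ V, partialT X p = f p ∧ partialX X p = g p := by
  let θ : BaseSpaceTX → BaseSpaceTX →L[ℝ] ℝ := fun p =>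
    f p • ContinuousLinearMap.fst ℝ ℝ ℝ + g p • ContinuousLinearMap.snd ℝ ℝ ℝ
  have hθ : ContDiffOn ℝ ∞ θ V :=
    (hf.smul contDiffOn_const).add (hg.smul contDiffOn_const)
  obtain ⟨X, hX⟩ := hV.exists_forall_hasFDerivAt_of_fderiv_symmetric hVo
    (hθ.differentiableOn (by simp)) (fun p hp v w => by
      have hd : HasFDerivAt θ _ p :=
        ((hf.differentiableAt_of_isOpen hVo hp).hasFDerivAt.smul_const
          (ContinuousLinearMap.fst ℝ ℝ ℝ)).add
        ((hg.differentiableAt_of_isOpen hVo hp).hasFDerivAt.smul_const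
          (ContinuousLinearMap.snd ℝ ℝ ℝ))
      rw [hd.fderiv]
      simp only [add_apply, ContinuousLinearMap.smulRight_apply,
        smul_apply, ContinuousLinearMap.coe_fst', ContinuousLinearMap.coe_snd',
        smul_eq_mul, fderiv_apply_eq_partial, h p hp]
      ring)
  refine ⟨X, (contDiffOn_infty_iff_fderiv_of_isOpen hVo).2
    ⟨fun p hp => (hX p hp).differentiableAt.differentiableWithinAt,
      hθ.congr fun p hp => (hX p hp).fderiv⟩, fun p hp => ?_⟩
  simp [partialT, partialX, (hX p hp).fderiv, θ]

/-! ### Sufficiency: the explicit reduction -/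

section Sufficiency

variable {V : Set BaseSpaceTX} {A C X : BaseSpaceTX → ℝ} {T : ℝ → ℝ}

/-- The map is triangular. Convexity makes the projection of `V` and its slices at fixed `t`
intervals, on which Rolle's theorem gives injectivity of `T`, then of `X(t, ·)`. -/
theorem isPointTransformation_affine (hVo : IsOpen V) (hV : Convex ℝ V)
    (hT : ContDiffOn ℝ ∞ T (Prod.fst '' V)) (hX : ContDiffOn ℝ ∞ X V)
    (hTt : ∀ p ∈ V, deriv T p.1 ≠ 0) (hXx : ∀ p ∈ V, partialX X p ≠ 0) :
    IsPointTransformation (V ×ˢ Set.univ) (affineTransformation T X (fun _ => 1) (fun _ => 0)) := by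
  have hΦ : affineTransformation T X (fun _ => 1) (fun _ => 0)
      = fun z => ((T z.1.1, X z.1), z.2) := by
    ext z <;> simp [affineTransformation]
  rw [hΦ]
  have hXd {p : BaseSpaceTX} (hp : p ∈ V) := hX.differentiableAt_of_isOpen hVo hp
  refine ⟨hVo.prod isOpen_univ, ?_, ?_, ?_⟩
  · have h1 : ContDiffOn ℝ ∞ (fun z : TotalSpaceTXU => T z.1.1) (V ×ˢ Set.univ) :=
      hT.comp (contDiff_fst.fst.contDiffOn) fun z hz => ⟨z.1, hz.1, rfl⟩
    have h2 : ContDiffOn ℝ ∞ (fun z : TotalSpaceTXU => X z.1) (V ×ˢ Set.univ) :=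
      hX.comp contDiffOn_fst fun z hz => hz.1
    exact (h1.prodMk h2).prodMk contDiffOn_snd
  · rintro ⟨⟨t, x⟩, u⟩ ⟨hz, -⟩ ⟨⟨t', x'⟩, u'⟩ ⟨hz', -⟩ h
    simp only [Prod.mk.injEq] at h hz hz'
    obtain ⟨⟨h1, h2⟩, rfl⟩ := h
    have hS : Convex ℝ (Prod.fst '' V) := hV.linear_image (LinearMap.fst ℝ ℝ ℝ)
    obtain rfl : t = t' := injOn_of_deriv_ne_zero hS (by rintro _ ⟨p, hp, rfl⟩; exact hTt p hp)
      ⟨_, hz, rfl⟩ ⟨_, hz', rfl⟩ h1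
    obtain rfl : x = x' := injOn_of_deriv_ne_zero (convex_slice hV t) (f := fun x => X (t, x))
      (fun y hy => by
        rw [(hasDerivAt_slice (p := (t, y)) (hXd hy)).deriv]
        exact hXx _ hy) hz hz' h2
    rfl
  · rintro z ⟨hz, -⟩
    have hTd : DifferentiableAt ℝ T z.1.1 := differentiableAt_of_deriv_ne_zero (hTt _ hz)
    have d1 : HasFDerivAt (fun z : TotalSpaceTXU => T z.1.1) _ z :=
      hTd.hasFDerivAt.comp z (hasFDerivAt_fst (p := z)).fst
    have d2 : HasFDerivAt (fun z : TotalSpaceTXU => X z.1) _ z :=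
      (hXd hz).hasFDerivAt.comp z (hasFDerivAt_fst (p := z))
    have d := (d1.prodMk d2).prodMk (hasFDerivAt_snd (𝕜 := ℝ) (p := z))
    have hinj : Function.Injective
        (fderiv ℝ (fun z : TotalSpaceTXU => ((T z.1.1, X z.1), z.2)) z).toLinearMap := by
      rw [← LinearMap.ker_eq_bot, LinearMap.ker_eq_bot']
      intro w hw
      have hw' : fderiv ℝ (fun z : TotalSpaceTXU => ((T z.1.1, X z.1), z.2)) z w = 0 := hw
      rw [d.fderiv] at hw'
      simp only [ContinuousLinearMap.prod_apply, ContinuousLinearMap.comp_apply,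
        ContinuousLinearMap.coe_fst', ContinuousLinearMap.coe_snd', Prod.mk_eq_zero,
        fderiv_apply_eq_partial, fderiv_eq_smul_deriv, smul_eq_mul] at hw'
      obtain ⟨⟨h1, h2⟩, h3⟩ := hw'
      have h1' : w.1.1 = 0 := (mul_eq_zero.1 h1).resolve_right (hTt _ hz)
      rw [h1', mul_zero, zero_add] at h2
      have h2' : w.1.2 = 0 := (mul_eq_zero.1 h2).resolve_left (hXx _ hz)
      exact Prod.ext (Prod.ext h1' h2') h3
    exact ⟨hinj, (LinearMap.injective_iff_surjective
      (f := (fderiv ℝ (fun z : TotalSpaceTXU => ((T z.1.1, X z.1), z.2)) z).toLinearMap)).1 hinj⟩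

/-- `X_t = -C_x` and `X_xx = -C_x / A` make the two extra terms linear in `u_x` cancel. The cleared
Burgers equation is then (1) times the nonzero factor `C^7 / A^5`. -/
theorem connects_affine (hVo : IsOpen V)
    (hA : ContDiffOn ℝ ∞ A V) (hC : ContDiffOn ℝ ∞ C V)
    (hA0 : ∀ p ∈ V, A p ≠ 0) (hC0 : ∀ p ∈ V, C p ≠ 0) (h : BurgersConstraints A C V)
    (hT : ContDiffOn ℝ ∞ T (Prod.fst '' V)) (hX : ContDiffOn ℝ ∞ X V)
    (hTt : ∀ p ∈ V, HasDerivAt T (C p ^ 2 / A p) p.1)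
    (hXt : ∀ p ∈ V, partialT X p = -partialX C p) (hXx : ∀ p ∈ V, partialX X p = C p / A p) :
    Connects (V ×ˢ Set.univ) (affineTransformation T X (fun _ => 1) (fun _ => 0)) A C
      (fun _ => 1) (fun _ => 1) := by
  intro u v p hm
  have hp : p ∈ V := hm.mem.1
  have hβ : baseMap (affineTransformation T X (fun _ => 1) (fun _ => 0)) u
      = fun q => (T q.1, X q) := rfl
  have hvs := hm.smooth_target
  have hge : u =ᶠ[𝓝 p] fun q => v (T q.1, X q) := by
    filter_upwards [hm.graph_eq] with q hq
    rw [hβ] at hq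
    simpa [affineTransformation] using hq
  rw [hβ] at hvs ⊢
  have hτs : ContDiffOn ℝ ∞ (fun q : BaseSpaceTX => T q.1) V :=
    hT.comp contDiffOn_fst fun q hq => ⟨q, hq, rfl⟩
  have two {f : BaseSpaceTX → ℝ} (hf : ContDiffOn ℝ ∞ f V) : ContDiffAt ℝ 2 f p :=
    (hf.contDiffAt (hVo.mem_nhds hp)).of_le ENat.LEInfty.out
  have hτd (w : BaseSpaceTX) : ∀ q ∈ V, dirDeriv w (fun q : BaseSpaceTX => T q.1) q
      = w.1 * (C q ^ 2 / A q) := fun q hq => by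
    have := (hTt q hq).hasFDerivAt.comp q (hasFDerivAt_fst (𝕜 := ℝ) (p := q))
    change fderiv ℝ (T ∘ Prod.fst) q w = _
    rw [this.fderiv]
    simp
  have τt : partialT (fun q : BaseSpaceTX => T q.1) p = C p ^ 2 / A p :=
    (hτd (1, 0) p hp).trans (one_mul _)
  have τx : ∀ q ∈ V, partialX (fun q : BaseSpaceTX => T q.1) q = 0 := fun q hq =>
    (hτd (0, 1) q hq).trans (zero_mul _)
  have τtx : partialT (partialX fun q : BaseSpaceTX => T q.1) p = 0 :=
    dirDeriv_eq_zero_on hVo τx (1, 0) p hp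
  have τxx : partialX (partialX fun q : BaseSpaceTX => T q.1) p = 0 :=
    dirDeriv_eq_zero_on hVo τx (0, 1) p hp
  have hCA : ContDiffOn ℝ ∞ (fun q => C q / A q) V := hC.div hA hA0
  have ξxx : C p * partialX (partialX X) p = -(partialX C p * (C p / A p)) := by
    have e1 : partialX (partialX X) p = partialX (fun q => C q / A q) p :=
      dirDeriv_congr_on hVo hXx (0, 1) p hp
    -- Writing `C^2/A` as `C · (C/A)` lets the first constraint give `X_xx` without differentiating
    -- `A`.
    have e2 : partialX (fun q => C q * (C q / A q)) p = 0 := by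
      rw [← (h p hp).1]
      congr 1
      ext q
      ring
    rw [partialX_eq_dirDeriv, dirDeriv_mul (hC.differentiableAt_of_isOpen hVo hp)
      (hCA.differentiableAt_of_isOpen hVo hp), ← partialX_eq_dirDeriv] at e2
    rw [e1]
    linear_combination e2
  have hAp := hA0 p hp
  have hCp := hC0 p hp
  have hJ : jacobianTX (fun q : BaseSpaceTX => T q.1) X p ≠ 0 := by
    rw [jacobianTX, τt, τx p hp, hXx p hp, zero_mul, sub_zero]
    exact mul_ne_zero (div_ne_zero (pow_ne_zero 2 hCp) hAp) (div_ne_zero hCp hAp)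
  rw [satisfiesAt_burgers_iff (two hτs) (two hX) (hvs.of_le ENat.LEInfty.out) hge hJ,
    ← DerivJet.burgers_of_iff (two hτs) (two hX) (hm.smooth_source.of_le ENat.LEInfty.out)]
  simp only [DerivJet.Burgers, DerivJet.jac, DerivJet.jacX, DerivJet.jacT, DerivJet.of, τt,
    τx p hp, τtx, τxx, hXt p hp, hXx p hp, SatisfiesAt]
  obtain ⟨i, hi⟩ : ∃ i, A p * i = 1 := ⟨(A p)⁻¹, mul_inv_cancel₀ hAp⟩
  have hi0 : i ≠ 0 := right_ne_zero_of_mul_eq_one hi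
  have hdiv (y : ℝ) : y / A p = y * i := by
    rw [div_eq_iff hAp]
    linear_combination -y * hi
  simp only [hdiv] at ξxx ⊢
  have hxx : partialX (partialX X) p = -(partialX C p * i) := by
    refine mul_left_cancel₀ hCp ?_
    linear_combination ξxx
  rw [hxx]
  have hk : C p ^ 7 * i ^ 5 ≠ 0 := mul_ne_zero (pow_ne_zero _ hCp) (pow_ne_zero _ hi0)
  constructor
  · intro H
    linear_combination C p ^ 7 * i ^ 5 * H
      + C p ^ 7 * i ^ 4 * partialX (partialX u) p * hi
  · intro H
    refine mul_left_cancel₀ hk ?_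
    linear_combination H - C p ^ 7 * i ^ 4 * partialX (partialX u) p * hi

theorem BurgersConstraints.exists_affine_reduction (hVo : IsOpen V) (hV : Convex ℝ V)
    (hA : ContDiffOn ℝ ∞ A V) (hC : ContDiffOn ℝ ∞ C V)
    (hA0 : ∀ p ∈ V, A p ≠ 0) (hC0 : ∀ p ∈ V, C p ≠ 0) (h : BurgersConstraints A C V) :
    ∃ (T : ℝ → ℝ) (X : BaseSpaceTX → ℝ),
      ContDiffOn ℝ ∞ T (Prod.fst '' V) ∧ ContDiffOn ℝ ∞ X V ∧
      (∀ p ∈ V, deriv T p.1 = C p ^ 2 / A p) ∧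
      (∀ p ∈ V, partialX X p = C p / A p) ∧
      ReducesToBurgers A C (V ×ˢ Set.univ)
        (affineTransformation T X (fun _ => 1) (fun _ => 0)) := by
  obtain ⟨T, hT, hTt⟩ := exists_time_primitive hVo hV ((hC.pow 2).div hA hA0)
    fun p hp => (h p hp).1
  -- For `U = u`, the formula for `X_t` found in the necessity part reduces to `X_t = -C_x`;
  -- closedness of this system is the second constraint.
  obtain ⟨X, hX, hXd⟩ := exists_potential hVo hV
    (f := fun p => -partialX C p) (g := fun p => C p / A p)
    (hC.dirDeriv hVo (0, 1)).neg (hC.div hA hA0) fun p hp => by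
      rw [(h p hp).2]
      exact (dirDeriv_neg (partialX C) p (0, 1)).symm
  refine ⟨T, X, hT, hX, fun p hp => (hTt p hp).deriv, fun p hp => (hXd p hp).2,
    isPointTransformation_affine hVo hV hT hX (fun p hp => ?_) (fun p hp => ?_),
    connects_affine hVo hA hC hA0 hC0 h hT hX hTt (fun p hp => (hXd p hp).1)
      fun p hp => (hXd p hp).2⟩
  · rw [(hTt p hp).deriv]
    exact div_ne_zero (pow_ne_zero 2 (hC0 p hp)) (hA0 p hp)
  · rw [(hXd p hp).2]
    exact div_ne_zero (hC0 p hp) (hA0 p hp)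

theorem BurgersConstraints.reducibleOver (hVo : IsOpen V) (hV : Convex ℝ V)
    (hA : ContDiffOn ℝ ∞ A V) (hC : ContDiffOn ℝ ∞ C V)
    (hA0 : ∀ p ∈ V, A p ≠ 0) (hC0 : ∀ p ∈ V, C p ≠ 0) (h : BurgersConstraints A C V) :
    ReducibleOver A C V := by
  obtain ⟨T, X, -, -, -, -, hΦ⟩ := h.exists_affine_reduction hVo hV hA hC hA0 hC0
  exact ⟨_, _, Set.fst_image_prod V Set.univ_nonempty, hΦ⟩

end Sufficiency

/-! ### The main theorem -/

theorem mainTheorem11 (Ω : Set BaseSpaceTX) (hΩ : IsOpen Ω) (A C : BaseSpaceTX → ℝ)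
    (hA : ContDiffOn ℝ ∞ A Ω) (hC : ContDiffOn ℝ ∞ C Ω)
    (hA0 : ∀ p ∈ Ω, A p ≠ 0) (hC0 : ∀ p ∈ Ω, C p ≠ 0) :
    (LocallyReducibleOn A C Ω ↔ BurgersConstraints A C Ω) ∧
    (Convex ℝ Ω → (ReducibleOver A C Ω ↔ BurgersConstraints A C Ω)) ∧
    (BurgersConstraints A C Ω →
      ∀ V : Set BaseSpaceTX, V ⊆ Ω → IsOpen V → Convex ℝ V →
        ∃ (T : ℝ → ℝ) (X : BaseSpaceTX → ℝ),
          ContDiffOn ℝ ∞ T (Prod.fst '' V) ∧ ContDiffOn ℝ ∞ X V ∧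
          (∀ p ∈ V, deriv T p.1 = C p ^ 2 / A p) ∧
          (∀ p ∈ V, partialX X p = C p / A p) ∧
          ReducesToBurgers A C (V ×ˢ Set.univ)
            (affineTransformation T X (fun _ => 1) (fun _ => 0))) := by
  refine ⟨⟨fun h p hp => ?_, fun h p hp => ?_⟩, fun hconv => ⟨fun h => ?_, fun h => ?_⟩,
    fun h V hVΩ hVo hV => ?_⟩
  · obtain ⟨V, hpV, hVΩ, hred⟩ := h p hp
    exact hred.burgersConstraints (hA.mono hVΩ) (hC.mono hVΩ) (fun q hq => hA0 q (hVΩ hq)) p hpV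
  · obtain ⟨r, hr, hball⟩ := Metric.isOpen_iff.1 hΩ p hp
    exact ⟨Metric.ball p r, Metric.mem_ball_self hr, hball,
      BurgersConstraints.reducibleOver Metric.isOpen_ball (convex_ball p r) (hA.mono hball)
        (hC.mono hball) (fun q hq => hA0 q (hball hq)) (fun q hq => hC0 q (hball hq))
        fun q hq => h q (hball hq)⟩
  · exact h.burgersConstraints hA hC hA0
  · exact h.reducibleOver hΩ hconv hA hC hA0 hC0
  · exact BurgersConstraints.exists_affine_reduction hVo hV (hA.mono hVΩ) (hC.mono hVΩ)
      (fun q hq => hA0 q (hVΩ hq)) (fun q hq => hC0 q (hVΩ hq)) fun q hq => h q (hVΩ hq)
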